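/- Let $X$ be a locally compact separable metric space, $m$ a Radon measure of full support on $X$, and $J$ a symmetric Radon measure on $X\times X\setminus d$, where $d$ is the diagonal. Let $\rho:X\times X\to[0,\infty]$ be a $J$-measurable pseudo metric with $$\int_{A\times X\setminus d}\rho(x,y)^2\,dJ(x,y)\le m(A)\qquad\text{for all measurable }A\subseteq X.$$ Put $B_r(x)=\{y:\rho(x,y)\le r\}$, assume $m(B_1(x))>0$ for all $x\in X$, and define in $[-\infty,\infty]$ $$\mu=\mu(x_0)=\liminf_{r\to\infty}\frac1r\log m(B_r(x_0)),\qquad \tilde\mu=\liminf_{r\to\infty}\frac1r\inf_{x\in X}\log\frac{m(B_r(x))}{m(B_1(x))},$$ where the last quotient is understood to be $\infty$ if $m(B_r(x))=\infty$. Let $\mathcal E$ be a densely defined, closed, symmetric, non-negative form on the real space $L^2(X,m)$ with domain $D$ such that $\mathcal E(u)=\int_{X\times X\setminus d}(u(x)-u(y))^2\,dJ(x,y)$ for $u\in D$, where the integral is evaluated at a quasi continuous representative of $u$; let $L$ be the associated self-adjoint operator, and let $\lambda_0(L)$ and $\lambda_0^{\mathrm{ess}}(L)$ be the infima of its spectrum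 and of its essential spectrum (with $\inf\emptyset=\infty$). Assume that for all $r\in\mathbb N$, $x\in X$ and all real $\alpha>\tilde\mu/2$ the function $$f_{r,x,\alpha}=\big((e^{\alpha r}\wedge e^{\alpha(2r-\rho(x,\cdot))})-1\big)\vee 0$$ belongs to $D$ (as a quasi continuous function; this is automatic from $f_{r,x,\alpha}\in D$ if $\rho$ is continuous). Then $$\lambda_0(L)\le\frac{\tilde\mu^2}{4},$$ and, for every $x_0\in X$ with $m(\bigcup_rB_r(x_0))=\infty$, $$\lambda_0^{\mathrm{ess}}(L)\le\frac{\mu(x_0)^2}{4}.$$ Suppose moreover that for some $\delta\in[0,1]$ the pseudo metric $\rho$ has jump size in $[\delta,1]$, that is, the measure $\rho^2\,dJ$ does not charge the set $\{(x,y):\rho(x,y)\notin[\delta,1]\}$. If $\tilde\mu<\infty$, then $$\lambda_0(L)\le\frac{2(e^{\tilde\mu/2}-1)^2}{\delta^2e^{\tilde\mu}+1},$$ and, for every $x_0\in X$ with $m(\bigcup_rB_r(x_0))=\infty$ and $\mu=\mu(x_0)<\infty$, $$\lambda_0^{\mathrm{ess}}(L)\le\frac{2(e^{\mu/2}-1)^2}{\delta^2e^{\mu}+1}.$$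 -/

import Mathlib

open MeasureTheory Filter Topology Set
open scoped ENNReal

noncomputable section

namespace JumpSpectrum

/-! Closed forms and their operators on a real Hilbert space -/

section Forms

variable {H : Type*} [NormedAddCommGroup H] [InnerProductSpace ℝ H]

/-- A densely defined, symmetric, non-negative, closed bilinear form on `H`: the domain is
complete for the norm `√(form u u + ‖u‖²)`. -/
structure ClosedForm (H : Type*) [NormedAddCommGroup H] [InnerProductSpace ℝ H] where
  dom : Submodule ℝ H
  form : dom →ₗ[ℝ] dom →ₗ[ℝ] ℝ
  dense : Dense (dom : Set H)
  symm : ∀ u v : dom, form u v = form v u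
  nonneg : ∀ u : dom, 0 ≤ form u u
  complete : ∀ u : ℕ → dom,
    (∀ ε > 0, ∃ N, ∀ i ≥ N, ∀ j ≥ N,
      form (u i - u j) (u i - u j) + ‖u i - u j‖ ^ 2 < ε) →
    ∃ w : dom, Tendsto (fun n => form (u n - w) (u n - w) + ‖u n - w‖ ^ 2) atTop (𝓝 0)

/-- The graph of the operator of a form: the pairs `(u, w)` such that `u` is in the form domain
and `form u v = ⟪w, v⟫` for all `v` in the form domain. -/
def ClosedForm.operatorGraph (E : ClosedForm H) : Submodule ℝ (H × H) where
  carrier := {p | ∃ h : p.1 ∈ E.dom, ∀ v : E.dom, E.form ⟨p.1, h⟩ v = inner ℝ p.2 (v : H)}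
  add_mem' := by
    rintro p q ⟨hp, hp'⟩ ⟨hq, hq'⟩
    refine ⟨E.dom.add_mem hp hq, fun v => ?_⟩
    have h : (⟨(p + q).1, E.dom.add_mem hp hq⟩ : E.dom) = ⟨p.1, hp⟩ + ⟨q.1, hq⟩ := rfl
    rw [h, map_add, LinearMap.add_apply, hp', hq', Prod.snd_add, inner_add_left]
  zero_mem' := by
    refine ⟨E.dom.zero_mem, fun v => ?_⟩
    have h : (⟨(0 : H × H).1, E.dom.zero_mem⟩ : E.dom) = 0 := rfl
    rw [h, map_zero, LinearMap.zero_apply, Prod.snd_zero, inner_zero_left]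
  smul_mem' := by
    rintro c p ⟨hp, hp'⟩
    refine ⟨E.dom.smul_mem c hp, fun v => ?_⟩
    have h : (⟨(c • p).1, E.dom.smul_mem c hp⟩ : E.dom) = c • ⟨p.1, hp⟩ := rfl
    rw [h, map_smul, LinearMap.smul_apply, hp', Prod.smul_snd, real_inner_smul_left, smul_eq_mul]

/-- The self-adjoint operator `L` arising from a closed form. -/
def ClosedForm.operator (E : ClosedForm H) : H →ₗ.[ℝ] H := E.operatorGraph.toLinearPMap

/-- The graph above is that of a function, and so it is the graph of `E.operator`. -/
theorem ClosedForm.graph_operator (E : ClosedForm H) : E.operator.graph = E.operatorGraph := by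
  refine Submodule.toLinearPMap_graph_eq _ ?_
  rintro ⟨u, w⟩ ⟨hu, hw⟩ (rfl : u = 0)
  refine E.dense.eq_zero_of_inner_left ℝ fun v hv => ?_
  have h : (⟨(0 : H), hu⟩ : E.dom) = 0 := rfl
  have := hw ⟨v, hv⟩
  rw [h, map_zero, LinearMap.zero_apply] at this
  exact this.symm

/-- The real resolvent set of a partially defined operator: `T - lam` maps the domain
bijectively onto `H`, with a bounded inverse. -/
def resolventSet (T : H →ₗ.[ℝ] H) : Set ℝ :=
  {lam | ∃ R : H →L[ℝ] H,
    (∀ w, ∃ h : R w ∈ T.domain, T ⟨R w, h⟩ - lam • R w = w) ∧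
    ∀ u : T.domain, R (T u - lam • (u : H)) = u}

/-- The spectrum; for a self-adjoint operator it is a subset of the real line. -/
def spectrum (T : H →ₗ.[ℝ] H) : Set ℝ := (resolventSet T)ᶜ

/-- The eigenspace `ker (T - lam)`, as a subspace of the domain of `T`. -/
def eigenspace (T : H →ₗ.[ℝ] H) (lam : ℝ) : Submodule ℝ T.domain :=
  LinearMap.ker (T.toFun - lam • T.domain.subtype)

/-- The discrete spectrum of a self-adjoint operator: isolated points of the spectrum with a
finite-dimensional eigenspace. -/
def discreteSpectrum (T : H →ₗ.[ℝ] H) : Set ℝ :=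
  {lam | lam ∈ spectrum T ∧ (∃ ε > 0, ∀ t ∈ spectrum T, |t - lam| < ε → t = lam) ∧
    FiniteDimensional ℝ (eigenspace T lam)}

/-- The essential spectrum of a self-adjoint operator. -/
def essSpectrum (T : H →ₗ.[ℝ] H) : Set ℝ := spectrum T \ discreteSpectrum T

/-- The bottom `inf σ(T)` of the spectrum (`+∞` if the spectrum is empty). -/
def bottom (T : H →ₗ.[ℝ] H) : EReal := ⨅ lam ∈ spectrum T, (lam : EReal)

/-- The bottom of the essential spectrum (`+∞` if the essential spectrum is empty). -/
def essBottom (T : H →ₗ.[ℝ] H) : EReal := ⨅ lam ∈ essSpectrum T, (lam : EReal)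

end Forms

/-! Pseudo metrics, volume growth, test functions -/

section Metric

variable {X : Type*}

/-- A pseudo metric with values in `[0, ∞]`. -/
structure IsPseudoMetric (ρ : X → X → ℝ≥0∞) : Prop where
  self : ∀ x, ρ x x = 0
  symm : ∀ x y, ρ x y = ρ y x
  triangle : ∀ x y z, ρ x z ≤ ρ x y + ρ y z

/-- The distance ball `B_r(x)`. -/
def ball (ρ : X → X → ℝ≥0∞) (x : X) (r : ℝ) : Set X := {y | ρ y x ≤ ENNReal.ofReal r}

/-- The test function `f_{r,x,α} = ((e^{αr} ∧ e^{α(2r - ρ(x,·))}) - 1) ∨ 0`, which is zero where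
`ρ(x,·) = ∞`. -/
def testFn (ρ : X → X → ℝ≥0∞) (r : ℕ) (x : X) (α : ℝ) : X → ℝ := fun y =>
  if ρ x y = ∞ then 0
  else max (min (Real.exp (α * r)) (Real.exp (α * (2 * r - (ρ x y).toReal))) - 1) 0

variable [MeasurableSpace X]

/-- The exponential volume growth `μ = liminf_{r → ∞} (1/r) log m(B_r(x₀))`. -/
def volumeGrowth (ρ : X → X → ℝ≥0∞) (m : Measure X) (x₀ : X) : EReal :=
  liminf (fun r : ℝ => ((1 / r : ℝ) : EReal) * ENNReal.log (m (ball ρ x₀ r))) atTop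

/-- The ratio `m(B_r(x)) / m(B_1(x))`, understood to be `∞` when `m(B_r(x)) = ∞`. -/
def volumeRatio (ρ : X → X → ℝ≥0∞) (m : Measure X) (x : X) (r : ℝ) : ℝ≥0∞ :=
  if m (ball ρ x r) = ∞ then ∞ else m (ball ρ x r) / m (ball ρ x 1)

/-- The minimal exponential volume growth
`liminf_{r → ∞} (1/r) inf_x log (m(B_r(x)) / m(B_1(x)))`. -/
def minVolumeGrowth (ρ : X → X → ℝ≥0∞) (m : Measure X) : EReal :=
  liminf (fun r : ℝ => ((1 / r : ℝ) : EReal) * ⨅ x, ENNReal.log (volumeRatio ρ m x r)) atTop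

/-- A symmetric Radon measure on `X × X` without the diagonal, regarded as a Borel measure on
`X × X` which does not charge the diagonal. -/
structure IsJumpMeasure [TopologicalSpace X] (J : Measure (X × X)) : Prop where
  diagonal : J (Set.diagonal X) = 0
  symm : J.map Prod.swap = J
  finite_of_isCompact : ∀ K : Set (X × X), IsCompact K → Disjoint K (Set.diagonal X) → J K < ∞

/-- `ρ` is adapted: `∫_{A × X} ρ² dJ ≤ m(A)` for all measurable `A`. -/
def IsAdapted (ρ : X → X → ℝ≥0∞) (J : Measure (X × X)) (m : Measure X) : Prop :=
  ∀ A : Set X, MeasurableSet A → ∫⁻ p in A ×ˢ univ, ρ p.1 p.2 ^ 2 ∂J ≤ m A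

/-- `ρ` has jump size in `[a, b]`: the measure `ρ² dJ` is carried by the set of pairs whose
distance lies in `[a, b]`. -/
def HasJumpSizeIn (ρ : X → X → ℝ≥0∞) (J : Measure (X × X)) (a b : ℝ) : Prop :=
  ∫⁻ p in {p : X × X | ρ p.1 p.2 ∈ Icc (ENNReal.ofReal a) (ENNReal.ofReal b)}ᶜ,
    ρ p.1 p.2 ^ 2 ∂J = 0

end Metric

/-! Forms on `L²(X, m)` given by a jump measure -/

section JumpForm

variable {X : Type*} [TopologicalSpace X] [MeasurableSpace X] {m : Measure X}

/-- The capacity `inf {‖v‖_E | v ∈ D, 1_U ≤ v}`, where `‖v‖_E = √(E(v) + ‖v‖²)`. -/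
def capacity (E : ClosedForm (Lp ℝ 2 m)) (U : Set X) : ℝ≥0∞ :=
  ⨅ (v : E.dom) (_ : ∀ᵐ x ∂m, U.indicator (fun _ => (1 : ℝ)) x ≤ (v : Lp ℝ 2 m) x),
    ENNReal.ofReal (Real.sqrt (E.form v v + ‖v‖ ^ 2))

/-- Quasi continuity with respect to a form. -/
def QuasiContinuous (E : ClosedForm (Lp ℝ 2 m)) (u : X → ℝ) : Prop :=
  ∀ ε : ℝ≥0∞, 0 < ε → ∃ U : Set X, IsOpen U ∧ capacity E U ≤ ε ∧ ContinuousOn u Uᶜ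

/-- The function `u` belongs to the form domain: it is square integrable, its class is in the
domain, and it is a quasi continuous representative of this class. -/
def MemDomain (E : ClosedForm (Lp ℝ 2 m)) (u : X → ℝ) : Prop :=
  QuasiContinuous E u ∧ ∃ h : MemLp u 2 m, h.toLp u ∈ E.dom

/-- `E` is the form of the jump measure `J`: `E(u) = ∫ (u(x) - u(y))² dJ(x,y)` for `u` in the
domain, where the integral is taken for a quasi continuous representative. -/
def IsJumpForm (E : ClosedForm (Lp ℝ 2 m)) (J : Measure (X × X)) : Prop :=
  ∀ (u : X → ℝ) (h : MemLp u 2 m) (hu : h.toLp u ∈ E.dom), QuasiContinuous E u →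
    ENNReal.ofReal (E.form ⟨h.toLp u, hu⟩ ⟨h.toLp u, hu⟩)
      = ∫⁻ p, ENNReal.ofReal ((u p.1 - u p.2) ^ 2) ∂J

end JumpForm

end JumpSpectrum

end

/-! The proof adapts Brooks' argument to jump forms. The test function is `exp g - 1`, where `g` is
`α`-Lipschitz for `ρ`, equal to `αr` on the ball of radius `r` and zero off the ball of radius `2r`.
The energy bound rests on `(e^a - e^b)² ≤ (C/2) ρ² (e^{2a} + e^{2b})` for `|a - b| ≤ αρ`: `C = α²`
always works (`expJumpBound_sq`), and a bounded jump size gives a second constant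
(`expJumpBound_jumpSize`). Integrating against `J`, symmetry and adaptedness bound the energy by `C
∫ ((f + 1)² + 1) dm` over the support of `f` (`lintegral_testFn_sub_sq_le`). This exceeds `C‖f‖²`
only by a small multiple of `‖f‖²` and a multiple of `m(B_{2r})`.

Since `‖f‖² ≥ (e^{αr} - 1)² m(B_r)`, the volume error is negligible once `m(B_{2r}) ≤ θ e^{2αr}
m(B_r)`. If this failed for all large `r`, iterating over doubled radii would force growth at every
rate below `2α` (`exists_log_growth`); so it holds for some large `r` whenever `2α` exceeds the
growth rate. Finally `α` decreases to half that rate.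

The spectral side uses resolvents only. The largest lower bound of the form lies in the spectrum
(`bottom_le`), and the largest lower bound modulo finite rank lies in the essential spectrum
(`mem_essSpectrum`). If the balls have unbounded volume, the normalised test functions are weakly
null, so finite-rank terms do not affect their Rayleigh quotients. -/

noncomputable section

namespace JumpSpectrum

section Spectrum

variable {H : Type*} [NormedAddCommGroup H] [InnerProductSpace ℝ H]

/-! ### Resolvents of the operator of a form -/

/-- `R` is the resolvent `(L - c)⁻¹` of the operator of the form `E`. -/
def ClosedForm.IsResolvent (E : ClosedForm H) (c : ℝ) (R : H →L[ℝ] H) : Prop :=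
  (∀ w, (R w, w + c • R w) ∈ E.operatorGraph) ∧
    ∀ u w, (u, w) ∈ E.operatorGraph → R (w - c • u) = u

theorem ClosedForm.exists_isResolvent (E : ClosedForm H) {c : ℝ}
    (hc : c ∈ resolventSet E.operator) : ∃ R, E.IsResolvent c R := by
  obtain ⟨R, h1, h2⟩ := hc
  refine ⟨R, fun w => ?_, fun u w huw => ?_⟩
  · obtain ⟨h, hw⟩ := h1 w
    have := E.operator.mem_graph ⟨R w, h⟩
    rw [E.graph_operator] at this
    rwa [← eq_add_of_sub_eq hw]
  · rw [← E.graph_operator, LinearPMap.mem_graph_iff] at huw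
    obtain ⟨y, rfl, rfl⟩ := huw
    exact h2 y

namespace ClosedForm.IsResolvent

variable {E : ClosedForm H} {c : ℝ} {R : H →L[ℝ] H}

theorem symm (hR : E.IsResolvent c R) (x y : H) : inner ℝ (R x) y = inner ℝ x (R y) := by
  obtain ⟨hx, hx'⟩ := hR.1 x
  obtain ⟨hy, hy'⟩ := hR.1 y
  have h1 := hx' ⟨R y, hy⟩
  have h2 := hy' ⟨R x, hx⟩
  rw [E.symm] at h1
  have h3 := h1.symm.trans h2
  simp only [inner_add_left, real_inner_smul_left] at h3
  rw [real_inner_comm (R x) (R y), real_inner_comm (R x) y] at h3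
  linarith

/-- Since `(L - c) R = 1`, one has `w - k R w = (L - c - k) R w`; the resolvent at `c + k` recovers
`R w`, and hence `w`, from it. -/
theorem exists_norm_le {k : ℝ} (hR : E.IsResolvent c R)
    (hk : c + k ∈ resolventSet E.operator) :
    ∃ C > 0, ∀ w, ‖w‖ ≤ C * ‖w - k • R w‖ := by
  obtain ⟨R', hR'⟩ := E.exists_isResolvent hk
  refine ⟨1 + |k| * ‖R'‖, by positivity, fun w => ?_⟩
  have h1 := hR'.2 _ _ (hR.1 w)
  rw [show w + c • R w - (c + k) • R w = w - k • R w by module] at h1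
  have h2 : ‖w‖ ≤ ‖w - k • R w‖ + ‖k • R w‖ := by
    simpa using norm_add_le (w - k • R w) (k • R w)
  have h3 := R'.le_opNorm (w - k • R w)
  rw [h1] at h3
  rw [norm_smul, Real.norm_eq_abs] at h2
  nlinarith [mul_le_mul_of_nonneg_left h3 (abs_nonneg k)]

/-- The resolvent is bounded by the inverse of the distance to the spectrum. -/
theorem mul_norm_le (hR : E.IsResolvent c R) {d : ℝ} (hd : 0 < d)
    (hgap : ∀ t, |t - c| < d → t ∈ resolventSet E.operator) (w : H) :
    d * ‖R w‖ ≤ ‖w‖ := by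
  suffices h : d * ‖R‖ ≤ 1 by
    calc d * ‖R w‖ ≤ d * (‖R‖ * ‖w‖) := by gcongr; exact R.le_opNorm w
      _ = d * ‖R‖ * ‖w‖ := by ring
      _ ≤ 1 * ‖w‖ := by gcongr
      _ = ‖w‖ := one_mul _
  -- Otherwise, with `κ = 1/‖R‖ < d`, both `c ± κ` are resolvent points, so `1 - κ²R²` is bounded
  -- below. For symmetric `R` this keeps `‖R x‖/‖x‖` uniformly below `‖R‖`, which is absurd.
  by_contra! hcon
  have hRpos : 0 < ‖R‖ := by
    by_contra! h
    nlinarith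
  set κ := ‖R‖⁻¹ with hκ
  have hκpos : 0 < κ := inv_pos.2 hRpos
  have hκR : κ * ‖R‖ = 1 := inv_mul_cancel₀ hRpos.ne'
  have hκd : κ < d := by
    by_contra! h
    nlinarith
  obtain ⟨C₁, hC₁, h₁⟩ := hR.exists_norm_le (k := κ) (hgap _ (by simpa [abs_of_pos hκpos]))
  obtain ⟨C₂, hC₂, h₂⟩ := hR.exists_norm_le (k := -κ)
    (hgap _ (by simpa [abs_of_pos hκpos]))
  set C := C₁ * C₂
  have hC : 0 < C := mul_pos hC₁ hC₂
  have key : ∀ x, ‖x‖ ^ 2 ≤ C ^ 2 * (‖x‖ ^ 2 - κ ^ 2 * ‖R x‖ ^ 2) := by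
    intro x
    have e1 : ‖x‖ ≤ C * ‖x - κ ^ 2 • R (R x)‖ := by
      have := h₂ (x - κ • R x)
      have h3 := h₁ x
      have e : x - κ • R x - -κ • R (x - κ • R x) = x - κ ^ 2 • R (R x) := by
        rw [map_sub, map_smul]; module
      rw [e] at this
      calc ‖x‖ ≤ C₁ * ‖x - κ • R x‖ := h3
        _ ≤ C₁ * (C₂ * ‖x - κ ^ 2 • R (R x)‖) := by gcongr
        _ = _ := by ring
    -- The square expands to `‖x‖² - 2κ²‖Rx‖² + κ⁴‖R²x‖²`, and `κ‖R²x‖ ≤ ‖Rx‖`.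
    have e2 : ‖x - κ ^ 2 • R (R x)‖ ^ 2 ≤ ‖x‖ ^ 2 - κ ^ 2 * ‖R x‖ ^ 2 := by
      rw [norm_sub_sq_real, real_inner_smul_right, ← hR.symm x (R x), real_inner_self_eq_norm_sq,
        norm_smul, Real.norm_eq_abs, abs_of_pos (by positivity)]
      have : κ * ‖R (R x)‖ ≤ ‖R x‖ := by
        calc κ * ‖R (R x)‖ ≤ κ * (‖R‖ * ‖R x‖) := by gcongr; exact R.le_opNorm _
          _ = κ * ‖R‖ * ‖R x‖ := by ring
          _ = ‖R x‖ := by rw [hκR, one_mul]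
      have : (κ * ‖R (R x)‖) ^ 2 ≤ ‖R x‖ ^ 2 := by gcongr
      nlinarith [mul_le_mul_of_nonneg_left this (sq_nonneg κ)]
    calc ‖x‖ ^ 2 ≤ (C * ‖x - κ ^ 2 • R (R x)‖) ^ 2 := by gcongr
      _ = C ^ 2 * ‖x - κ ^ 2 • R (R x)‖ ^ 2 := by ring
      _ ≤ _ := by gcongr
  have hq : ∀ x, ‖R x‖ ^ 2 ≤ ‖R‖ ^ 2 * (1 - (C ^ 2)⁻¹) * ‖x‖ ^ 2 := by
    intro x
    have h1 := key x
    have h2 : κ ^ 2 * ‖R x‖ ^ 2 ≤ (1 - (C ^ 2)⁻¹) * ‖x‖ ^ 2 := by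
      have : (C ^ 2)⁻¹ * ‖x‖ ^ 2 ≤ ‖x‖ ^ 2 - κ ^ 2 * ‖R x‖ ^ 2 := by
        rwa [inv_mul_le_iff₀ (by positivity)]
      linarith
    calc ‖R x‖ ^ 2 = ‖R‖ ^ 2 * (κ ^ 2 * ‖R x‖ ^ 2) := by
          rw [← mul_assoc, ← mul_pow, mul_comm ‖R‖, hκR]; ring
      _ ≤ ‖R‖ ^ 2 * ((1 - (C ^ 2)⁻¹) * ‖x‖ ^ 2) := by gcongr
      _ = _ := by ring
  have hfac : 0 ≤ 1 - (C ^ 2)⁻¹ := by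
    by_contra! hneg
    refine hRpos.ne' (le_antisymm (R.opNorm_le_bound le_rfl fun x => ?_) hRpos.le)
    have h1 := hq x
    have : ‖R‖ ^ 2 * (1 - (C ^ 2)⁻¹) * ‖x‖ ^ 2 ≤ 0 := by
      apply mul_nonpos_of_nonpos_of_nonneg _ (sq_nonneg _)
      exact mul_nonpos_of_nonneg_of_nonpos (sq_nonneg _) hneg.le
    have : ‖R x‖ = 0 := by nlinarith [norm_nonneg (R x)]
    rw [this, zero_mul]
  have hle : ‖R‖ ≤ ‖R‖ * √(1 - (C ^ 2)⁻¹) := by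
    refine R.opNorm_le_bound (by positivity) fun x => ?_
    refine abs_le_of_sq_le_sq' ?_ (by positivity) |>.2
    rw [mul_pow, mul_pow, Real.sq_sqrt hfac]
    exact hq x
  have hlt : √(1 - (C ^ 2)⁻¹) < 1 := by
    rw [Real.sqrt_lt' one_pos]
    have : 0 < (C ^ 2)⁻¹ := by positivity
    linarith
  nlinarith

end ClosedForm.IsResolvent

/-! ### The bottom of the spectrum -/

theorem ClosedForm.cauchy_schwarz {V : Type*} [AddCommGroup V] [Module ℝ V]
    (B : V →ₗ[ℝ] V →ₗ[ℝ] ℝ) (hs : ∀ u v, B u v = B v u) (hn : ∀ u, 0 ≤ B u u) (u v : V) :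
    B u v ^ 2 ≤ B u u * B v v := by
  have h : ∀ t : ℝ, 0 ≤ B v v * (t * t) + (2 * B u v) * t + B u u := fun t => by
    have := hn (u + t • v)
    simp only [map_add, map_smul, LinearMap.add_apply, LinearMap.smul_apply, smul_eq_mul,
      hs v u] at this
    linarith
  have := discrim_le_zero h
  rw [discrim] at this
  linarith

/-- The bottom of the spectrum is bounded by Rayleigh quotients. -/
theorem ClosedForm.bottom_le (E : ClosedForm H) {b : ℝ} (u : E.dom) (hu : u ≠ 0)
    (hb : E.form u u ≤ b * ‖u‖ ^ 2) : bottom E.operator ≤ b := by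
  set S : Set ℝ := {c | ∀ v : E.dom, c * ‖v‖ ^ 2 ≤ E.form v v}
  have hup : ∀ c ∈ S, c ≤ b := fun c hc => by
    have hp : 0 < ‖u‖ ^ 2 := by positivity
    exact le_of_mul_le_mul_right ((hc u).trans hb) hp
  have h0 : (0 : ℝ) ∈ S := fun v => by simpa using E.nonneg v
  have hbdd : BddAbove S := ⟨b, hup⟩
  set s := sSup S
  have hs : s ∈ S := fun v => by
    rcases eq_or_ne v 0 with rfl | hv
    · simp
    have hp : 0 < ‖v‖ ^ 2 := by positivity
    rw [← le_div_iff₀ hp]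
    exact csSup_le ⟨0, h0⟩ fun c hc => (le_div_iff₀ hp).2 (hc v)
  have hsb : s ≤ b := csSup_le ⟨0, h0⟩ hup
  -- With a resolvent at `s` and `B = E - s`, one has `B(Rv, w) = ⟨v, w⟩`. Cauchy–Schwarz gives
  -- `‖v‖⁴ ≤ ⟨v, Rv⟩ B(v, v)`, so `B` is coercive and `s` could be raised. The `+ 1` in `(‖R‖ +
  -- 1)⁻¹` avoids inverting zero.
  have hspec : s ∈ spectrum E.operator := by
    intro hres
    obtain ⟨R, hR⟩ := E.exists_isResolvent hres
    set B : E.dom →ₗ[ℝ] E.dom →ₗ[ℝ] ℝ :=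
      E.form - s • (innerₗ H).compl₁₂ E.dom.subtype E.dom.subtype with hB
    have hBa : ∀ v w : E.dom, B v w = E.form v w - s * inner ℝ (v : H) (w : H) := fun v w => by
      simp [hB]
    have hBn : ∀ v, 0 ≤ B v v := fun v => by
      rw [hBa, real_inner_self_eq_norm_sq]
      exact sub_nonneg.2 (hs v)
    have hBs : ∀ v w, B v w = B w v := fun v w => by
      rw [hBa, hBa, E.symm, real_inner_comm]
    have key : ∀ v : E.dom, (‖R‖ + 1)⁻¹ * ‖v‖ ^ 2 ≤ B v v := by
      intro v
      rcases eq_or_ne v 0 with rfl | hv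
      · simp
      have hp : 0 < ‖v‖ := norm_pos_iff.2 hv
      obtain ⟨hm, hm'⟩ := hR.1 v
      have h1 : ∀ w : E.dom, B ⟨R v, hm⟩ w = inner ℝ (v : H) (w : H) := fun w => by
        rw [hBa, hm', inner_add_left, real_inner_smul_left]; ring
      have h2 := ClosedForm.cauchy_schwarz B hBs hBn ⟨R v, hm⟩ v
      rw [h1, h1, real_inner_self_eq_norm_sq] at h2
      have h3 : inner ℝ (v : H) (R v) ≤ ‖(v : H)‖ * (‖R‖ * ‖(v : H)‖) :=
        (real_inner_le_norm _ _).trans (by gcongr; exact R.le_opNorm _)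
      have h4 : (‖v‖ ^ 2) ^ 2 ≤ (‖R‖ + 1) * ‖v‖ ^ 2 * B v v := by
        refine h2.trans (mul_le_mul_of_nonneg_right (h3.trans ?_) (hBn v))
        have : ‖(v : H)‖ = ‖v‖ := rfl
        rw [this]
        nlinarith [sq_nonneg ‖v‖]
      rw [inv_mul_le_iff₀ (by positivity)]
      have hp2 : 0 < ‖v‖ ^ 2 := by positivity
      nlinarith
    have : s + (‖R‖ + 1)⁻¹ ∈ S := fun v => by
      have := key v
      rw [hBa, real_inner_self_eq_norm_sq] at this
      have e : ‖(v : H)‖ = ‖v‖ := rfl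
      rw [e] at this
      linarith
    have h1 := le_csSup hbdd this
    have h2 : 0 < (‖R‖ + 1)⁻¹ := by positivity
    linarith
  exact (iInf₂_le s hspec).trans (EReal.coe_le_coe_iff.2 hsb)

/-! ### The bottom of the essential spectrum -/

/-- If `lam` is isolated in the spectrum, then `1 + η (L - lam - η)⁻¹` is bounded below on the
orthogonal complement of the eigenspace of `lam`. -/
theorem ClosedForm.IsResolvent.norm_le_of_isolated [CompleteSpace H] {E : ClosedForm H}
    {lam η : ℝ} (hη : 0 < η)
    (hgap : ∀ t, t ≠ lam → |t - lam| < 2 * η → t ∈ resolventSet E.operator)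
    {R : H →L[ℝ] H} (hR : E.IsResolvent (lam + η) R) (N : Submodule ℝ H)
    (hN : ∀ u, (u, lam • u) ∈ E.operatorGraph → u ∈ N) {v : H} (hv : v ∈ Nᗮ) :
    2 * ‖v‖ ≤ 3 * ‖v + η • R v‖ := by
  -- Formally `G = (L - lam)(L - lam - η)⁻¹`, the multiplier `μ/(μ - η)`, which is at least `2/3`
  -- where `|μ| ≥ 2η`. The estimates below obtain this without a functional calculus.
  set G : H →L[ℝ] H := ContinuousLinearMap.id ℝ H + η • R with hG
  have hGa : ∀ w, G w = w + η • R w := fun w => by simp [hG]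
  have hGs : ∀ x y, inner ℝ (G x) y = inner ℝ x (G y) := fun x y => by
    simp only [hGa, inner_add_left, inner_add_right, real_inner_smul_left,
      real_inner_smul_right, hR.symm]
  have hright : ∀ w, η * ‖R w‖ ≤ ‖w‖ := hR.mul_norm_le hη fun t ht => by
    rw [abs_lt] at ht
    exact hgap t (by linarith) (by rw [abs_lt]; constructor <;> linarith)
  obtain ⟨R', hR'⟩ := E.exists_isResolvent (c := lam - η)
    (hgap _ (by linarith) (by rw [abs_lt]; constructor <;> linarith))
  have hleft : ∀ w, η * ‖R w‖ ≤ ‖w + (2 * η) • R w‖ := fun w => by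
    have h1 := hR'.2 _ _ (hR.1 w)
    rw [show w + (lam + η) • R w - (lam - η) • R w = w + (2 * η) • R w by module] at h1
    conv_lhs => rw [← h1]
    refine hR'.mul_norm_le hη (fun t ht => ?_) _
    rw [abs_lt] at ht
    exact hgap t (by linarith) (by rw [abs_lt]; constructor <;> linarith)
  have hpos : ∀ w, 0 ≤ inner ℝ (G w) w := fun w => by
    rw [hGa, inner_add_left, real_inner_self_eq_norm_sq, real_inner_smul_left]
    have h1 := neg_le_of_abs_le (abs_real_inner_le_norm (R w) w)
    nlinarith [hright w, norm_nonneg w, norm_nonneg (R w),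
      mul_le_mul_of_nonneg_right (hright w) (norm_nonneg w), mul_le_mul_of_nonneg_left h1 hη.le]
  -- Comparison with the resolvent at `lam - η` reads `‖(G - 1)w‖ ≤ ‖(2G - 1)w‖`, which expands to
  -- `2G ≤ 3G²` as quadratic forms.
  have hupper : ∀ w, 2 * inner ℝ (G w) w ≤ 3 * ‖G w‖ ^ 2 := fun w => by
    have e1 : η • R w = G w - w := by rw [hGa]; module
    have e2 : w + (2 * η) • R w = (2 : ℝ) • G w - w := by rw [hGa]; module
    have h := hleft w
    rw [e2, ← abs_of_pos hη, ← Real.norm_eq_abs, ← norm_smul, e1] at h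
    have h2 : ‖G w - w‖ ^ 2 ≤ ‖(2 : ℝ) • G w - w‖ ^ 2 := by gcongr
    rw [norm_sub_sq_real, norm_sub_sq_real, norm_smul, real_inner_smul_left] at h2
    norm_num at h2
    linarith
  -- Cauchy–Schwarz for the non-negative form `⟨G·, ·⟩`, applied to `w` and `G w`, turns the
  -- quadratic inequality into a norm bound on the range of `G`.
  have hrange : ∀ w, 2 * ‖G w‖ ≤ 3 * ‖G (G w)‖ := fun w => by
    rcases (norm_nonneg (G w)).eq_or_lt with h0 | h0
    · rw [← h0]; simp
    have h1 := ClosedForm.cauchy_schwarz ((innerₗ H).comp (G : H →ₗ[ℝ] H))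
      (fun x y => by simp [hGs x y, real_inner_comm]) (fun x => by simpa using hpos x) w (G w)
    simp only [LinearMap.comp_apply, ContinuousLinearMap.coe_coe, innerₗ_apply_apply,
      real_inner_self_eq_norm_sq] at h1
    have h2 : inner ℝ (G (G w)) (G w) ≤ ‖G (G w)‖ * ‖G w‖ := real_inner_le_norm _ _
    have h3 := hupper w
    have h4 : (‖G w‖ ^ 2) ^ 2 ≤ (3 / 2 * ‖G w‖ ^ 2) * (‖G (G w)‖ * ‖G w‖) := by
      refine h1.trans (mul_le_mul (by linarith) h2 (hpos _) (by positivity))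
    have h5 : ‖G w‖ ^ 3 * (2 * ‖G w‖) ≤ ‖G w‖ ^ 3 * (3 * ‖G (G w)‖) := by nlinarith
    exact le_of_mul_le_mul_left h5 (by positivity)
  rw [← hGa]
  -- If `G w = 0` then `w = -η R w` is in the operator domain and `L w = lam w`. Thus `ker G ⊆ N`,
  -- and `Nᗮ` lies in `(ker G)ᗮ`, the closure of the range.
  have hsub : Nᗮ ≤ (G : H →ₗ[ℝ] H).range.topologicalClosure := by
    rw [← Submodule.orthogonal_orthogonal_eq_closure]
    refine Submodule.orthogonal_le fun w hw => hN w ?_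
    have h0 : G w = 0 := ext_inner_right ℝ fun y => by
      rw [inner_zero_left, hGs, real_inner_comm]
      exact hw _ ⟨y, rfl⟩
    rw [hGa] at h0
    have h1 : w = -(η • R w) := eq_neg_of_add_eq_zero_left h0
    have h2 := E.operatorGraph.smul_mem (-η) (hR.1 w)
    rw [Prod.smul_mk, neg_smul, ← h1] at h2
    convert h2 using 2
    have h3 : w + (lam + η) • R w = lam • R w := by
      nth_rw 1 [h1]; module
    rw [h3, smul_comm, neg_smul, ← h1]
  have hclosed : IsClosed {x : H | 2 * ‖x‖ ≤ 3 * ‖G x‖} :=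
    isClosed_le (by fun_prop) (by fun_prop)
  refine closure_minimal ?_ hclosed (hsub hv)
  rintro _ ⟨w, rfl⟩
  exact hrange w

/-- The form is at least `lam` up to a form of finite rank. -/
def ClosedForm.BoundedBelowModFinite (E : ClosedForm H) (lam : ℝ) : Prop :=
  ∃ (F : Finset H) (C : ℝ), ∀ u : E.dom,
    lam * ‖u‖ ^ 2 ≤ E.form u u + C * ∑ v ∈ F, (inner ℝ v (u : H)) ^ 2

theorem ClosedForm.BoundedBelowModFinite.mono {E : ClosedForm H} {a b : ℝ} (hab : a ≤ b)
    (h : E.BoundedBelowModFinite b) : E.BoundedBelowModFinite a := by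
  obtain ⟨F, C, h⟩ := h
  exact ⟨F, C, fun u => le_trans (by gcongr) (h u)⟩

/-- A weakly null net of unit vectors with small energy. -/
theorem ClosedForm.exists_weakly_null (E : ClosedForm H) {s : ℝ}
    (hs : ∀ ε > 0, ¬ E.BoundedBelowModFinite (s + ε)) :
    ∃ f : Finset H × ℕ → E.dom, (∀ i, ‖f i‖ = 1) ∧
      (∀ i, E.form (f i) (f i) ≤ s + 1 / ((i.2 : ℝ) + 1)) ∧
      ∀ v : H, Tendsto (fun i => inner ℝ v (f i : H)) atTop (𝓝 0) := by
  -- The index consists of the finite set to be penalised and the size of the penalty; a net is used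
  -- because `H` need not be separable.
  have h1 : ∀ i : Finset H × ℕ, ∃ u : E.dom, ‖u‖ = 1 ∧
      E.form u u + ((i.2 : ℝ) + 1) * ∑ v ∈ i.1, (inner ℝ v (u : H)) ^ 2
        ≤ s + 1 / ((i.2 : ℝ) + 1) := by
    intro i
    have h2 := hs (1 / ((i.2 : ℝ) + 1)) (by positivity)
    simp only [ClosedForm.BoundedBelowModFinite, not_exists, not_forall, not_le] at h2
    obtain ⟨u, hu⟩ := h2 i.1 ((i.2 : ℝ) + 1)
    have hu0 : u ≠ 0 := by
      rintro rfl
      simp at hu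
    have hp : 0 < ‖u‖ := norm_pos_iff.2 hu0
    refine ⟨‖u‖⁻¹ • u, by rw [norm_smul, norm_inv, norm_norm, inv_mul_cancel₀ hp.ne'], ?_⟩
    have e : E.form (‖u‖⁻¹ • u) (‖u‖⁻¹ • u) + ((i.2 : ℝ) + 1) *
        ∑ v ∈ i.1, (inner ℝ v ((‖u‖⁻¹ • u : E.dom) : H)) ^ 2 =
        (‖u‖⁻¹) ^ 2 * (E.form u u + ((i.2 : ℝ) + 1) * ∑ v ∈ i.1, (inner ℝ v (u : H)) ^ 2) := by
      simp only [map_smul, LinearMap.smul_apply, smul_eq_mul, Submodule.coe_smul,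
        real_inner_smul_right, mul_pow, ← Finset.mul_sum]
      ring
    rw [e]
    calc _ ≤ (‖u‖⁻¹) ^ 2 * ((s + 1 / ((i.2 : ℝ) + 1)) * ‖u‖ ^ 2) := by gcongr
      _ = _ := by field_simp
  choose f hf1 hf2 using h1
  refine ⟨f, hf1, fun i => ?_, fun v => ?_⟩
  · have : 0 ≤ ((i.2 : ℝ) + 1) * ∑ v ∈ i.1, (inner ℝ v (f i : H)) ^ 2 := by positivity
    linarith [hf2 i]
  · have hlim : Tendsto (fun i : Finset H × ℕ => (s + 1) / ((i.2 : ℝ) + 1)) atTop (𝓝 0) := by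
      have h3 : Tendsto (fun n : ℕ => (s + 1) / ((n : ℝ) + 1)) atTop (𝓝 0) := by
        have := (tendsto_one_div_add_atTop_nhds_zero_nat (𝕜 := ℝ)).const_mul (s + 1)
        simpa [div_eq_mul_inv] using this
      exact h3.comp (by rw [← prod_atTop_atTop_eq]; exact tendsto_snd)
    have hsq : Tendsto (fun i => (inner ℝ v (f i : H)) ^ 2) atTop (𝓝 0) := by
      refine squeeze_zero' (Eventually.of_forall fun i => sq_nonneg _) ?_ hlim
      filter_upwards [eventually_ge_atTop ({v}, 0)] with i hi
      have hvi : v ∈ i.1 := hi.1 (Finset.mem_singleton_self v)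
      have h4 : (inner ℝ v (f i : H)) ^ 2 ≤ ∑ v ∈ i.1, (inner ℝ v (f i : H)) ^ 2 :=
        Finset.single_le_sum (f := fun v => (inner ℝ v (f i : H)) ^ 2)
          (fun _ _ => sq_nonneg _) hvi
      rw [le_div_iff₀ (by positivity)]
      have h5 := hf2 i
      have h6 := E.nonneg (f i)
      have h7 : 1 / ((i.2 : ℝ) + 1) ≤ 1 := by
        rw [div_le_one (by positivity)]
        linarith [(Nat.cast_nonneg i.2 : (0 : ℝ) ≤ i.2)]
      have h8 : (0 : ℝ) < (i.2 : ℝ) + 1 := by positivity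
      nlinarith
    refine (tendsto_zero_iff_abs_tendsto_zero _).2 ?_
    have := hsq.sqrt
    simpa [Real.sqrt_sq_eq_abs, Function.comp_def] using this

/-- Along a weakly null net which is minimizing modulo forms of finite rank,
`1 + η (L - s - η)⁻¹` tends to zero. -/
theorem ClosedForm.IsResolvent.tendsto_zero_of_minimizing {E : ClosedForm H} {s η : ℝ}
    {R : H →L[ℝ] H} (hR : E.IsResolvent (s + η) R)
    (hs : ∀ τ > 0, E.BoundedBelowModFinite (s - τ))
    {ι : Type*} {l : Filter ι} {f : ι → E.dom} {b : ι → ℝ} (hf1 : ∀ i, ‖f i‖ = 1)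
    (hf2 : ∀ i, E.form (f i) (f i) ≤ s + b i) (hb : Tendsto b l (𝓝 0))
    (hf3 : ∀ v : H, Tendsto (fun i => inner ℝ v (f i : H)) l (𝓝 0)) :
    Tendsto (fun i => (f i : H) + η • R (f i)) l (𝓝 0) := by
  set G : H →L[ℝ] H := ContinuousLinearMap.id ℝ H + η • R with hG
  have hGa : ∀ w, G w = w + η • R w := fun w => by simp [hG]
  have hGs : ∀ x y, inner ℝ (G x) y = inner ℝ x (G y) := fun x y => by
    simp only [hGa, inner_add_left, inner_add_right, real_inner_smul_left,
      real_inner_smul_right, hR.symm]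
  simp only [← hGa]
  choose hm hm' using hR.1
  -- The direction `v = R G f` satisfies `(L - s) v = G² f`, so the cross term of `E - s` between
  -- `f` and `v` is `‖G f‖²`. Perturbing the near-minimiser `f` to `f - t v` would lower the energy
  -- too much unless `G f` is small.
  set v : ι → E.dom := fun i => ⟨R (G (f i)), hm _⟩ with hv
  have hvE : ∀ i (u : E.dom), E.form (v i) u - s * inner ℝ (v i : H) (u : H) =
      inner ℝ (G (G (f i))) (u : H) := fun i u => by
    rw [hm', hGa (G (f i)), inner_add_left, inner_add_left, real_inner_smul_left,
      real_inner_smul_left]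
    ring
  have hn1 : ∀ i, ‖(f i : H)‖ = 1 := hf1
  set g := ‖G‖
  set r := ‖R‖
  have hGf : ∀ i, ‖G (f i)‖ ≤ g := fun i => by simpa [hn1] using G.le_opNorm (f i)
  have hvn : ∀ i, ‖(v i : H)‖ ≤ r * g := fun i =>
    (R.le_opNorm _).trans (by gcongr; exact hGf i)
  have hGG : ∀ i, ‖G (G (f i))‖ ≤ g * g := fun i =>
    (G.le_opNorm _).trans (by gcongr; exact hGf i)
  have hvv : ∀ i, E.form (v i) (v i) - s * ‖(v i : H)‖ ^ 2 ≤ g * g * (r * g) := fun i => by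
    rw [← real_inner_self_eq_norm_sq, hvE]
    exact (real_inner_le_norm _ _).trans
      (mul_le_mul (hGG i) (hvn i) (norm_nonneg _) (by positivity))
  have hg0 : 0 ≤ g := norm_nonneg _
  have hr0 : 0 ≤ r := norm_nonneg _
  have hfv : ∀ i, E.form (f i) (v i) - s * inner ℝ (f i : H) (v i : H) = ‖G (f i)‖ ^ 2 :=
    fun i => by
      rw [E.symm, real_inner_comm, hvE, hGs, real_inner_self_eq_norm_sq]
  have main : ∀ ε > 0, ∀ᶠ i in l, ‖G (f i)‖ ^ 2 < ε := by
    intro ε hε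
    set C₁ := g * g * (r * g)
    set C₂ := (1 + r * g) ^ 2
    have hC₁ : 0 ≤ C₁ := by positivity
    have hC₂ : 0 < C₂ := by positivity
    set t := min 1 (ε / (C₁ + 1)) with ht
    have ht0 : 0 < t := by positivity
    have ht1 : t ≤ 1 := min_le_left _ _
    have htC : t * C₁ ≤ ε := by
      have : t * (C₁ + 1) ≤ ε := by
        rw [← le_div_iff₀ (by positivity)]
        exact min_le_right _ _
      nlinarith
    -- Here `t` is already fixed, so the loss in the lower bound may be small compared with `tε`;
    -- only then are the finite-rank terms made small along the net.
    obtain ⟨F, C, hFC⟩ := hs (t * ε / (4 * C₂)) (by positivity)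
    have hsum : Tendsto (fun i => b i + C * ∑ x ∈ F, (inner ℝ x (f i - t • v i : H)) ^ 2)
        l (𝓝 0) := by
      have h1 : ∀ x : H, Tendsto (fun i => (inner ℝ x (f i - t • v i : H)) ^ 2) l (𝓝 0) := by
        intro x
        have e : ∀ i, inner ℝ x (f i - t • v i : H) =
            inner ℝ x (f i : H) - t * inner ℝ (G (R x)) (f i : H) := fun i => by
          rw [inner_sub_right, real_inner_smul_right, hGs, hR.symm]
        simp only [e]
        have := ((hf3 x).sub ((hf3 (G (R x))).const_mul t)).pow 2
        simpa using this
      have h2 := hb.add ((tendsto_finsetSum F fun x _ => h1 x).const_mul C)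
      simpa using h2
    have hev := hsum.eventually_lt_const (show 0 < t * ε / 2 by positivity)
    filter_upwards [hev] with i hi
    have h3 := hFC (f i - t • v i)
    have h4 : ‖f i - t • v i‖ ^ 2 ≤ C₂ := by
      have : ‖(f i - t • v i : H)‖ ≤ 1 + r * g := by
        refine (norm_sub_le _ _).trans ?_
        rw [hn1, norm_smul, Real.norm_eq_abs, abs_of_pos ht0]
        nlinarith [hvn i, norm_nonneg (v i : H)]
      have h5 : ‖f i - t • v i‖ ≤ 1 + r * g := this
      exact pow_le_pow_left₀ (norm_nonneg _) h5 2
    have h6 : E.form (f i - t • v i) (f i - t • v i) - s * ‖f i - t • v i‖ ^ 2 =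
        (E.form (f i) (f i) - s) - 2 * t * ‖G (f i)‖ ^ 2 +
          t ^ 2 * (E.form (v i) (v i) - s * ‖(v i : H)‖ ^ 2) := by
      have e1 : ‖f i - t • v i‖ ^ 2 = 1 - 2 * t * inner ℝ (f i : H) (v i : H) +
          t ^ 2 * ‖(v i : H)‖ ^ 2 := by
        have : ‖f i - t • v i‖ = ‖(f i - t • v i : H)‖ := rfl
        rw [this, norm_sub_sq_real, hn1, norm_smul, real_inner_smul_right, mul_pow,
          Real.norm_eq_abs, sq_abs]
        ring
      rw [← hfv, e1]
      simp only [map_sub, map_smul, LinearMap.sub_apply, LinearMap.smul_apply, smul_eq_mul,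
        E.symm (v i) (f i)]
      ring
    have h7 : t ^ 2 * (E.form (v i) (v i) - s * ‖(v i : H)‖ ^ 2) ≤ t * ε := by
      calc _ ≤ t ^ 2 * C₁ := by gcongr; exact hvv i
        _ = t * (t * C₁) := by ring
        _ ≤ t * ε := by gcongr
    have h8 : t * ε / (4 * C₂) * ‖f i - t • v i‖ ^ 2 ≤ t * ε / 4 := by
      calc _ ≤ t * ε / (4 * C₂) * C₂ := by gcongr
        _ = _ := by field_simp
    have h9 := hf2 i
    have hcoe : ((f i - t • v i : E.dom) : H) = (f i - t • v i : H) := rfl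
    rw [hcoe] at h3
    have : 2 * t * ‖G (f i)‖ ^ 2 < 2 * t * ε := by nlinarith [mul_pos ht0 hε]
    exact lt_of_mul_lt_mul_left this (by positivity)
  rw [tendsto_zero_iff_norm_tendsto_zero, Metric.tendsto_nhds]
  intro ε hε
  filter_upwards [main (ε ^ 2) (by positivity)] with i hi
  rw [Real.dist_eq, sub_zero, abs_norm]
  exact lt_of_pow_lt_pow_left₀ 2 hε.le hi

/-- The projection is a finite sum of inner products against an orthonormal basis, so weak
convergence becomes norm convergence. -/
theorem tendsto_starProjection_zero {ι : Type*} {l : Filter ι} (N : Submodule ℝ H)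
    [FiniteDimensional ℝ N] {f : ι → H}
    (hf : ∀ v : H, Tendsto (fun i => inner ℝ v (f i)) l (𝓝 0)) :
    Tendsto (fun i => N.starProjection (f i)) l (𝓝 0) := by
  set e := stdOrthonormalBasis ℝ N
  have h : ∀ x, N.starProjection x = ∑ k, (inner ℝ (e k : H) x) • (e k : H) := fun x => by
    rw [e.starProjection_eq_sum_rankOne]
    simp [InnerProductSpace.rankOne_apply]
  simp only [h]
  have := tendsto_finsetSum (f := fun k i => (inner ℝ (e k : H) (f i)) • (e k : H))
    (x := l) Finset.univ fun k _ => (hf (e k)).smul_const (e k : H)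
  simpa using this

/-- The essential spectrum contains the supremum of all lower bounds modulo finite rank. -/
theorem ClosedForm.mem_essSpectrum [CompleteSpace H] (E : ClosedForm H) {s : ℝ}
    (hs : ∀ τ > 0, E.BoundedBelowModFinite (s - τ))
    (hs' : ∀ ε > 0, ¬ E.BoundedBelowModFinite (s + ε)) : s ∈ essSpectrum E.operator := by
  classical
  obtain ⟨f, hf1, hf2, hf3⟩ := E.exists_weakly_null hs'
  have hb : Tendsto (fun i : Finset H × ℕ => 1 / ((i.2 : ℝ) + 1)) atTop (𝓝 0) :=
    (tendsto_one_div_add_atTop_nhds_zero_nat (𝕜 := ℝ)).comp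
      (by rw [← prod_atTop_atTop_eq]; exact tendsto_snd)
  have hn : ∀ i, ‖(f i : H)‖ = 1 := hf1
  have hnot : ¬ Tendsto (fun i => (f i : H)) atTop (𝓝 0) := fun h => by
    have := h.norm
    simp only [hn, norm_zero] at this
    exact one_ne_zero (tendsto_nhds_unique tendsto_const_nhds this)
  refine ⟨fun hres => ?_, fun hdisc => ?_⟩
  · obtain ⟨R, hR⟩ := E.exists_isResolvent hres
    -- With `η = 0` the operator `1 + ηR` is the identity, so the unit vectors themselves would tend
    -- to zero.
    have hR' : E.IsResolvent (s + 0) R := by rwa [add_zero]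
    have := hR'.tendsto_zero_of_minimizing hs hf1 hf2 hb hf3
    simp only [zero_smul, add_zero] at this
    exact hnot this
  -- A finite-dimensional eigenspace captures no mass of a weakly null net in the limit, and off it
  -- `1 + ηR` is bounded below with `η = ε/4`; again the unit vectors would tend to zero.
  · obtain ⟨-, ⟨ε, hε, hiso⟩, hfin⟩ := hdisc
    have hgap : ∀ t, t ≠ s → |t - s| < 2 * (ε / 2) → t ∈ resolventSet E.operator := by
      intro t ht h1
      by_contra hcon
      exact ht (hiso t hcon (by linarith))
    obtain ⟨R, hR⟩ := E.exists_isResolvent (c := s + ε / 4)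
      (hgap _ (by linarith) (by rw [add_sub_cancel_left, abs_of_pos] <;> linarith))
    set N : Submodule ℝ H := (eigenspace E.operator s).map E.operator.domain.subtype with hN
    have hNm : ∀ u, (u, s • u) ∈ E.operatorGraph → u ∈ N := by
      intro u hu
      rw [← E.graph_operator, LinearPMap.mem_graph_iff] at hu
      obtain ⟨y, rfl, hy⟩ := hu
      refine ⟨y, ?_, rfl⟩
      simp only [SetLike.mem_coe, eigenspace, LinearMap.mem_ker, LinearMap.sub_apply,
        LinearMap.smul_apply, Submodule.subtype_apply, sub_eq_zero]
      exact hy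
    have : FiniteDimensional ℝ N := Module.Finite.map _ _
    have h1 := hR.tendsto_zero_of_minimizing hs hf1 hf2 hb hf3
    have h2 := tendsto_starProjection_zero N hf3
    set P := N.starProjection
    have h3 : Tendsto (fun i => ((f i : H) - P (f i)) + (ε / 4) • R ((f i : H) - P (f i)))
        atTop (𝓝 0) := by
      have h4 := h1.sub (h2.add (((R.continuous.tendsto 0).comp h2).const_smul (ε / 4)))
      simp only [map_zero, smul_zero, add_zero, sub_zero] at h4
      refine h4.congr fun i => ?_
      simp only [Function.comp_apply, map_sub, smul_sub]
      abel
    have h5 : Tendsto (fun i => (f i : H) - P (f i)) atTop (𝓝 0) := by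
      have h6 := h3.norm.const_mul (3 / 2)
      simp only [norm_zero, mul_zero] at h6
      refine squeeze_zero_norm (fun i => ?_) h6
      have := hR.norm_le_of_isolated (by positivity)
        (fun t ht h => hgap t ht (by linarith)) N hNm
        (N.sub_starProjection_mem_orthogonal (f i : H))
      linarith
    refine hnot ?_
    have := h5.add h2
    simpa using this

/-- The bottom of the essential spectrum is bounded by the Rayleigh quotients of a weakly null
sequence. -/
theorem ClosedForm.essBottom_le [CompleteSpace H] (E : ClosedForm H) {b : ℝ} (f : ℕ → E.dom)
    (hf0 : ∀ n, f n ≠ 0) (hb : ∀ n, E.form (f n) (f n) ≤ b * ‖f n‖ ^ 2)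
    (hw : ∀ v : H, Tendsto (fun n => inner ℝ v (f n : H) / ‖f n‖) atTop (𝓝 0)) :
    essBottom E.operator ≤ b := by
  set S : Set ℝ := {c | E.BoundedBelowModFinite c}
  have hup : ∀ c ∈ S, c ≤ b := by
    rintro c ⟨F, C, h⟩
    have h1 : Tendsto (fun n => b + C * ∑ v ∈ F, (inner ℝ v (f n : H) / ‖f n‖) ^ 2) atTop
        (𝓝 b) := by
      have := ((tendsto_finsetSum F fun v _ => (hw v).pow 2).const_mul C).const_add b
      simpa using this
    refine ge_of_tendsto' h1 fun n => ?_
    have hp : 0 < ‖f n‖ ^ 2 := by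
      have := norm_pos_iff.2 (hf0 n)
      positivity
    refine le_of_mul_le_mul_right ?_ hp
    calc c * ‖f n‖ ^ 2 ≤ _ := h (f n)
      _ ≤ b * ‖f n‖ ^ 2 + C * ∑ v ∈ F, (inner ℝ v (f n : H)) ^ 2 := by gcongr; exact hb n
      _ = _ := by
        simp only [div_pow, ← Finset.sum_div]
        rw [add_mul, mul_assoc C, div_mul_cancel₀ _ hp.ne']
  have h0 : (0 : ℝ) ∈ S := ⟨∅, 0, fun u => by simpa using E.nonneg u⟩
  have hbdd : BddAbove S := ⟨b, hup⟩
  have hmem : sSup S ∈ essSpectrum E.operator := by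
    refine E.mem_essSpectrum (fun τ hτ => ?_) fun ε hε h => ?_
    · obtain ⟨c, hc, hlt⟩ := exists_lt_of_lt_csSup ⟨0, h0⟩ (show sSup S - τ < sSup S by linarith)
      exact ClosedForm.BoundedBelowModFinite.mono hlt.le hc
    · have := le_csSup hbdd h
      linarith
  exact (iInf₂_le _ hmem).trans (EReal.coe_le_coe_iff.2 (csSup_le ⟨0, h0⟩ hup))

end Spectrum

/-! ### Exponential inequalities -/

/-- Convexity: the integral of `exp` over `[0, s]` is at most its trapezoidal value. -/
theorem exp_sub_one_le_trapezoid {s : ℝ} (hs : 0 ≤ s) :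
    Real.exp s - 1 ≤ s * (Real.exp s + 1) / 2 := by
  have hmono : MonotoneOn (fun s : ℝ => s * (Real.exp s + 1) / 2 - Real.exp s) (Ici 0) := by
    refine monotoneOn_of_deriv_nonneg (convex_Ici 0) (by fun_prop) (by fun_prop) fun x _ => ?_
    have h : HasDerivAt (fun s : ℝ => s * (Real.exp s + 1) / 2 - Real.exp s)
        ((1 * (Real.exp x + 1) + x * Real.exp x) / 2 - Real.exp x) x :=
      (((hasDerivAt_id x).mul ((Real.hasDerivAt_exp x).add_const 1)).div_const 2).sub
        (Real.hasDerivAt_exp x)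
    rw [h.deriv]
    have h1 := Real.add_one_le_exp (-x)
    have h2 : Real.exp (-x) * Real.exp x = 1 := by rw [← Real.exp_add]; simp
    nlinarith [Real.exp_pos x]
  have := hmono (mem_Ici.2 le_rfl) (mem_Ici.2 hs) hs
  simp at this
  linarith

/-- The exponential satisfies the jump inequality with constant `C` at distance `h`. -/
def ExpJumpBound (α C h : ℝ) : Prop :=
  ∀ a b : ℝ, |a - b| ≤ α * h →
    (Real.exp a - Real.exp b) ^ 2 ≤
      C / 2 * h ^ 2 * (Real.exp a ^ 2 + Real.exp b ^ 2)

/-- The inequality is symmetric in `a, b` and homogeneous under division by `e^{2b}`, leaving only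
`s = a - b ≥ 0`. -/
theorem expJumpBound_of_nonneg {α C h : ℝ}
    (H : ∀ s, 0 ≤ s → s ≤ α * h →
      (Real.exp s - 1) ^ 2 ≤ C / 2 * h ^ 2 * (Real.exp s ^ 2 + 1)) : ExpJumpBound α C h := by
  have key : ∀ a b : ℝ, b ≤ a → |a - b| ≤ α * h →
      (Real.exp a - Real.exp b) ^ 2 ≤
        C / 2 * h ^ 2 * (Real.exp a ^ 2 + Real.exp b ^ 2) := by
    intro a b hab hle
    have h1 := H (a - b) (by linarith) ((le_abs_self _).trans hle)
    have h2 : Real.exp a = Real.exp (a - b) * Real.exp b := by rw [← Real.exp_add]; simp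
    rw [h2]
    have h3 := mul_le_mul_of_nonneg_right h1 (sq_nonneg (Real.exp b))
    linarith
  intro a b hab
  rcases le_total b a with h | h
  · exact key a b h hab
  · have := key b a h (by rwa [abs_sub_comm])
    rw [add_comm, ← neg_sq, neg_sub]
    exact this

theorem expJumpBound_sq {α h : ℝ} : ExpJumpBound α (α ^ 2) h := by
  refine expJumpBound_of_nonneg fun s hs hle => ?_
  have h1 := exp_sub_one_le_trapezoid hs
  have h2 : 0 ≤ Real.exp s - 1 := by linarith [Real.add_one_le_exp s]
  have h3 : s ^ 2 ≤ (α * h) ^ 2 := pow_le_pow_left₀ hs hle 2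
  calc (Real.exp s - 1) ^ 2 ≤ (s * (Real.exp s + 1) / 2) ^ 2 := pow_le_pow_left₀ h2 h1 2
    _ = s ^ 2 * ((Real.exp s + 1) ^ 2 / 4) := by ring
    _ ≤ s ^ 2 * ((Real.exp s ^ 2 + 1) / 2) := by
        refine mul_le_mul_of_nonneg_left ?_ (sq_nonneg s)
        nlinarith [sq_nonneg (Real.exp s - 1)]
    _ ≤ (α * h) ^ 2 * ((Real.exp s ^ 2 + 1) / 2) := by gcongr
    _ = _ := by ring

theorem expJumpBound_jumpSize {α δ h : ℝ} (hα : 0 ≤ α) (hδ : 0 ≤ δ) (hδh : δ ≤ h)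
    (h1 : h ≤ 1) :
    ExpJumpBound α (2 * (Real.exp α - 1) ^ 2 / (δ ^ 2 * Real.exp α ^ 2 + 1)) h := by
  refine expJumpBound_of_nonneg fun s hs hle => ?_
  have hh : 0 ≤ h := hδ.trans hδh
  set p := Real.exp s
  set P := Real.exp (α * h) with hP
  set Q := Real.exp α with hQ
  have hp1 : 1 ≤ p := Real.one_le_exp hs
  have hpP : p ≤ P := Real.exp_le_exp.2 hle
  have hP1 : 1 ≤ P := hp1.trans hpP
  have hPQ : P ≤ Q := Real.exp_le_exp.2 (by nlinarith)
  have hconv : P - 1 ≤ h * (Q - 1) := by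
    have := convexOn_exp.2 (mem_univ α) (mem_univ 0) hh (sub_nonneg.2 h1) (by ring)
    simp only [smul_eq_mul, mul_zero, add_zero, Real.exp_zero, mul_one] at this
    rw [mul_comm h α] at this
    linarith
  -- The function `(p - 1)²/(p² + 1)` increases for `p ≥ 1`, so the worst case is `s = αh`.
  have hA : (p - 1) ^ 2 * (P ^ 2 + 1) ≤ (P - 1) ^ 2 * (p ^ 2 + 1) := by
    have : 0 ≤ (P - p) * (p * P - 1) :=
      mul_nonneg (by linarith) (by nlinarith)
    nlinarith
  -- The two terms of the denominator are treated separately: convexity gives `P - 1 ≤ h(Q - 1)`,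
  -- while `δ ≤ h` and `(P - 1)/P ≤ (Q - 1)/Q` handle the term with `δ²`.
  have hB : (P - 1) ^ 2 * (δ ^ 2 * Q ^ 2 + 1) ≤ h ^ 2 * (Q - 1) ^ 2 * (P ^ 2 + 1) := by
    have e1 : (P - 1) ^ 2 ≤ (h * (Q - 1)) ^ 2 := pow_le_pow_left₀ (by linarith) hconv 2
    have e2 : ((P - 1) * Q) ^ 2 ≤ ((Q - 1) * P) ^ 2 :=
      pow_le_pow_left₀ (mul_nonneg (by linarith) (by linarith)) (by nlinarith) 2
    have e3 : δ ^ 2 ≤ h ^ 2 := pow_le_pow_left₀ hδ hδh 2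
    calc (P - 1) ^ 2 * (δ ^ 2 * Q ^ 2 + 1) = δ ^ 2 * ((P - 1) * Q) ^ 2 + (P - 1) ^ 2 := by ring
      _ ≤ h ^ 2 * ((Q - 1) * P) ^ 2 + (h * (Q - 1)) ^ 2 := by gcongr
      _ = _ := by ring
  have hD : 0 < δ ^ 2 * Q ^ 2 + 1 := by positivity
  have hC : (p - 1) ^ 2 * (δ ^ 2 * Q ^ 2 + 1) ≤ h ^ 2 * (Q - 1) ^ 2 * (p ^ 2 + 1) := by
    refine le_of_mul_le_mul_right ?_ (show 0 < P ^ 2 + 1 by positivity)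
    calc _ = (p - 1) ^ 2 * (P ^ 2 + 1) * (δ ^ 2 * Q ^ 2 + 1) := by ring
      _ ≤ (P - 1) ^ 2 * (p ^ 2 + 1) * (δ ^ 2 * Q ^ 2 + 1) := by gcongr
      _ = (P - 1) ^ 2 * (δ ^ 2 * Q ^ 2 + 1) * (p ^ 2 + 1) := by ring
      _ ≤ h ^ 2 * (Q - 1) ^ 2 * (P ^ 2 + 1) * (p ^ 2 + 1) := by gcongr
      _ = _ := by ring
  have e : 2 * (Q - 1) ^ 2 / (δ ^ 2 * Q ^ 2 + 1) / 2 * h ^ 2 * (p ^ 2 + 1) =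
      h ^ 2 * (Q - 1) ^ 2 * (p ^ 2 + 1) / (δ ^ 2 * Q ^ 2 + 1) := by
    field_simp
  rw [e, le_div_iff₀ hD]
  exact hC

/-! ### The test functions -/

section TestFunction

variable {X : Type*} {ρ : X → X → ℝ≥0∞}

/-- The exponent of the test function: `testFn ρ r x α = exp (testExponent ρ r x α) - 1`. -/
def testExponent (ρ : X → X → ℝ≥0∞) (r : ℕ) (x : X) (α : ℝ) : X → ℝ := fun y =>
  if ρ x y = ∞ then 0 else max (min (α * r) (α * (2 * r - (ρ x y).toReal))) 0

theorem testFn_eq (ρ : X → X → ℝ≥0∞) (r : ℕ) (x : X) (α : ℝ) (y : X) :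
    testFn ρ r x α y = Real.exp (testExponent ρ r x α y) - 1 := by
  unfold testFn testExponent
  split_ifs with h
  · simp
  · rw [Real.exp_monotone.map_max, Real.exp_monotone.map_min, Real.exp_zero,
      ← max_sub_sub_right, sub_self]

theorem testFn_nonneg (ρ : X → X → ℝ≥0∞) (r : ℕ) (x : X) (α : ℝ) (y : X) :
    0 ≤ testFn ρ r x α y := by
  unfold testFn
  split_ifs
  · exact le_rfl
  · exact le_max_right _ _

theorem testFn_le (ρ : X → X → ℝ≥0∞) (r : ℕ) (x : X) {α : ℝ} (hα : 0 ≤ α) (y : X) :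
    testFn ρ r x α y ≤ Real.exp (α * r) - 1 := by
  rw [testFn_eq]
  gcongr
  unfold testExponent
  split_ifs
  · positivity
  · exact max_le (min_le_left _ _) (by positivity)

theorem testFn_eq_of_mem_ball (hρ : IsPseudoMetric ρ) {r : ℕ} {x : X} {α : ℝ} (hα : 0 ≤ α)
    {y : X} (hy : y ∈ ball ρ x r) : testFn ρ r x α y = Real.exp (α * r) - 1 := by
  have h1 : ρ x y ≤ ENNReal.ofReal r := by rw [hρ.symm]; exact hy
  have h2 : ρ x y ≠ ∞ := (h1.trans_lt ENNReal.ofReal_lt_top).ne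
  have h3 : (ρ x y).toReal ≤ r := ENNReal.toReal_le_of_le_ofReal (by positivity) h1
  rw [testFn_eq, testExponent, if_neg h2, min_eq_left, max_eq_left (by positivity)]
  gcongr
  linarith

theorem mem_ball_of_testFn_ne_zero (hρ : IsPseudoMetric ρ) {r : ℕ} {x : X} {α : ℝ}
    (hα : 0 < α) {y : X} (hy : testFn ρ r x α y ≠ 0) : y ∈ ball ρ x (2 * r) := by
  rw [testFn_eq, testExponent] at hy
  by_cases h : ρ x y = ∞
  · simp [h] at hy
  rw [if_neg h] at hy
  by_contra hcon
  refine hy ?_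
  have h1 : ENNReal.ofReal (2 * r) < ρ x y := by
    rw [hρ.symm]
    exact not_le.1 hcon
  have h2 := (ENNReal.ofReal_lt_iff_lt_toReal (by positivity) h).1 h1
  rw [max_eq_right, Real.exp_zero, sub_self]
  exact (min_le_right _ _).trans (mul_nonpos_of_nonneg_of_nonpos hα.le (by linarith))

/-- Points at finite distance from each other are both at finite or both at infinite distance from
`x`, so the value zero at infinite distance does not break the Lipschitz bound. -/
theorem abs_testExponent_sub_le (hρ : IsPseudoMetric ρ) (r : ℕ) (x : X) {α : ℝ} (hα : 0 ≤ α)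
    {y z : X} (hyz : ρ y z ≠ ∞) :
    |testExponent ρ r x α y - testExponent ρ r x α z| ≤ α * (ρ y z).toReal := by
  have hiff : ρ x y = ∞ ↔ ρ x z = ∞ := by
    have h1 := hρ.triangle x y z
    have h2 := hρ.triangle x z y
    rw [hρ.symm z y] at h2
    constructor <;> intro h <;> by_contra hcon
    · rw [h, top_le_iff] at h2
      exact ENNReal.add_ne_top.2 ⟨hcon, hyz⟩ h2
    · rw [h, top_le_iff] at h1
      exact ENNReal.add_ne_top.2 ⟨hcon, hyz⟩ h1
  unfold testExponent
  by_cases hy : ρ x y = ∞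
  · rw [if_pos hy, if_pos (hiff.1 hy)]
    simpa using by positivity
  · have hz : ρ x z ≠ ∞ := fun h => hy (hiff.2 h)
    rw [if_neg hy, if_neg hz]
    have h1 : (ρ x z).toReal ≤ (ρ x y).toReal + (ρ y z).toReal := by
      rw [← ENNReal.toReal_add hy hyz]
      exact ENNReal.toReal_mono (ENNReal.add_ne_top.2 ⟨hy, hyz⟩) (hρ.triangle x y z)
    have h2 : (ρ x y).toReal ≤ (ρ x z).toReal + (ρ y z).toReal := by
      rw [← ENNReal.toReal_add hz hyz, hρ.symm y z]
      refine ENNReal.toReal_mono (ENNReal.add_ne_top.2 ⟨hz, ?_⟩) (hρ.triangle x z y)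
      rwa [hρ.symm]
    refine (abs_max_sub_max_le_abs _ _ _).trans ?_
    refine (abs_min_sub_min_le_max _ _ _ _).trans ?_
    rw [sub_self, abs_zero]
    refine max_le (by positivity) ?_
    rw [← mul_sub, abs_mul, abs_of_nonneg hα]
    gcongr
    rw [abs_le]
    constructor <;> linarith

end TestFunction

/-! ### The energy of the test functions -/

section Energy

variable {X : Type*} [MeasurableSpace X] {ρ : X → X → ℝ≥0∞} {J : Measure (X × X)} {m : Measure X}

/-- The first marginal of `ρ² dJ` is at most `m`. -/
theorem IsAdapted.map_fst_le (h : IsAdapted ρ J m) :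
    (J.withDensity fun p => ρ p.1 p.2 ^ 2).map Prod.fst ≤ m := by
  refine Measure.le_iff.2 fun A hA => ?_
  rw [Measure.map_apply measurable_fst hA, withDensity_apply _ (measurable_fst hA)]
  have : (Prod.fst ⁻¹' A : Set (X × X)) = A ×ˢ univ := by ext; simp
  rw [this]
  exact h A hA

theorem IsAdapted.lintegral_fst_le (h : IsAdapted ρ J m)
    (hρJ : AEMeasurable (fun p : X × X => ρ p.1 p.2) J) {g : X → ℝ≥0∞} (hg : Measurable g) :
    ∫⁻ p, ρ p.1 p.2 ^ 2 * g p.1 ∂J ≤ ∫⁻ x, g x ∂m := by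
  have h1 := lintegral_withDensity_eq_lintegral_mul₀' (hρJ.pow_const 2)
    (g := fun p : X × X => g p.1) (hg.comp measurable_fst).aemeasurable
  simp only [Pi.mul_apply] at h1
  rw [← h1, ← lintegral_map hg measurable_fst]
  exact lintegral_mono' h.map_fst_le le_rfl

/-- Adaptedness controls the marginal of `ρ² dJ`, not of `J`; hence null sets transfer only where `ρ
≠ 0`. -/
theorem IsAdapted.ae_fst (h : IsAdapted ρ J m)
    (hρJ : AEMeasurable (fun p : X × X => ρ p.1 p.2) J) {P : X → Prop} (hP : ∀ᵐ x ∂m, P x) :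
    ∀ᵐ p ∂J, ρ p.1 p.2 ≠ 0 → P p.1 := by
  have h1 : ∀ᵐ x ∂(J.withDensity fun p => ρ p.1 p.2 ^ 2).map Prod.fst, P x :=
    Measure.absolutelyContinuous_of_le h.map_fst_le hP
  have h2 := ae_of_ae_map measurable_fst.aemeasurable h1
  rw [ae_withDensity_iff' (hρJ.pow_const 2)] at h2
  filter_upwards [h2] with p hp hne
  exact hp (pow_ne_zero 2 hne)

variable [TopologicalSpace X]

theorem IsJumpMeasure.measurePreserving_swap (hJ : IsJumpMeasure J) :
    MeasurePreserving Prod.swap J J := ⟨measurable_swap, hJ.symm⟩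

/-- The energy estimate for the test functions. -/
theorem lintegral_testFn_sub_sq_le (hJ : IsJumpMeasure J) (hρ : IsPseudoMetric ρ)
    (hρJ : AEMeasurable (fun p : X × X => ρ p.1 p.2) J) (h : IsAdapted ρ J m)
    {α C : ℝ} (hα : 0 < α) (hC : 0 < C)
    (hbound : ∀ᵐ p ∂J, ρ p.1 p.2 ≠ ∞ → ExpJumpBound α C (ρ p.1 p.2).toReal)
    (r : ℕ) (x : X) (hf : AEMeasurable (testFn ρ r x α) m) :
    ∫⁻ p, ENNReal.ofReal ((testFn ρ r x α p.1 - testFn ρ r x α p.2) ^ 2) ∂J ≤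
      ENNReal.ofReal C * ∫⁻ y, {y | testFn ρ r x α y ≠ 0}.indicator
        (fun y => ENNReal.ofReal ((testFn ρ r x α y + 1) ^ 2 + 1)) y ∂m := by
  set f := testFn ρ r x α with hfdef
  set A : X → ℝ≥0∞ := {y | f y ≠ 0}.indicator (fun y => ENNReal.ofReal ((f y + 1) ^ 2 + 1))
    with hA
  have hAm : AEMeasurable A m := by
    have hg : Measurable fun t : ℝ => ({0}ᶜ : Set ℝ).indicator
        (fun t => ENNReal.ofReal ((t + 1) ^ 2 + 1)) t :=
      Measurable.indicator (by fun_prop) (measurableSet_singleton 0).compl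
    have := hg.comp_aemeasurable hf
    exact this
  -- The marginal bound needs a measurable integrand. Changing `A` on an `m`-null set is harmless
  -- for `J` where `ρ ≠ 0`, and where `ρ = 0` the test function has equal values at both points.
  set A' := hAm.mk A
  have hA'm : Measurable A' := hAm.measurable_mk
  have hfst : ∀ᵐ p ∂J, ρ p.1 p.2 ≠ 0 → A p.1 = A' p.1 := h.ae_fst hρJ hAm.ae_eq_mk
  have hsnd : ∀ᵐ p ∂J, ρ p.1 p.2 ≠ 0 → A p.2 = A' p.2 := by
    filter_upwards [hJ.measurePreserving_swap.quasiMeasurePreserving.ae hfst] with p hp hne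
    exact hp (by rwa [Prod.fst_swap, Prod.snd_swap, hρ.symm])
  have hpt : ∀ᵐ p ∂J, ENNReal.ofReal ((f p.1 - f p.2) ^ 2) ≤
      ENNReal.ofReal (C / 2) * (ρ p.1 p.2 ^ 2 * A' p.1 + ρ p.1 p.2 ^ 2 * A' p.2) := by
    filter_upwards [hfst, hsnd, hbound] with p h1 h2 h3
    by_cases h0 : f p.1 = 0 ∧ f p.2 = 0
    · simp [h0.1, h0.2]
    have hAne : A p.1 + A p.2 ≠ 0 := by
      intro hcon
      rw [add_eq_zero] at hcon
      refine h0 ⟨?_, ?_⟩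
      · by_contra hne
        have := hcon.1
        rw [hA, indicator_of_mem (by exact hne), ENNReal.ofReal_eq_zero] at this
        nlinarith [sq_nonneg (f p.1 + 1)]
      · by_contra hne
        have := hcon.2
        rw [hA, indicator_of_mem (by exact hne), ENNReal.ofReal_eq_zero] at this
        nlinarith [sq_nonneg (f p.2 + 1)]
    by_cases htop : ρ p.1 p.2 = ∞
    · have hne : ρ p.1 p.2 ≠ 0 := by simp [htop]
      rw [← h1 hne, ← h2 hne, ← mul_add, htop, ENNReal.top_pow two_ne_zero,
        ENNReal.top_mul hAne, ENNReal.mul_top]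
      · exact le_top
      · rw [Ne, ENNReal.ofReal_eq_zero]; linarith
    have hexp := abs_testExponent_sub_le hρ r x hα.le htop
    have hJB := h3 htop _ _ hexp
    have hf1 : ∀ y, Real.exp (testExponent ρ r x α y) = f y + 1 := fun y => by
      rw [hfdef, testFn_eq]; ring
    rw [hf1, hf1] at hJB
    by_cases hzero : ρ p.1 p.2 = 0
    · rw [hzero] at hJB
      have : (f p.1 - f p.2) ^ 2 ≤ 0 := by
        have e : f p.1 + 1 - (f p.2 + 1) = f p.1 - f p.2 := by ring
        rw [e] at hJB
        simpa using hJB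
      rw [ENNReal.ofReal_eq_zero.2 this]
      exact bot_le
    rw [← h1 hzero, ← h2 hzero, ← mul_add]
    -- If just one point lies in the support, the other contributes `(0 + 1)² = 1`; the `+ 1` in `A`
    -- pays for it.
    have hAA : ENNReal.ofReal ((f p.1 + 1) ^ 2 + (f p.2 + 1) ^ 2) ≤ A p.1 + A p.2 := by
      by_cases z1 : f p.1 = 0
      · have z2 : f p.2 ≠ 0 := fun z2 => h0 ⟨z1, z2⟩
        have : A p.2 = ENNReal.ofReal ((f p.2 + 1) ^ 2 + 1) := indicator_of_mem (by exact z2) _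
        rw [this, z1]
        refine le_add_left (le_of_eq ?_)
        congr 1
        ring
      · have e1 : A p.1 = ENNReal.ofReal ((f p.1 + 1) ^ 2 + 1) := indicator_of_mem (by exact z1) _
        by_cases z2 : f p.2 = 0
        · rw [e1, z2]
          refine le_add_right (le_of_eq ?_)
          congr 1
          ring
        · have e2 : A p.2 = ENNReal.ofReal ((f p.2 + 1) ^ 2 + 1) :=
            indicator_of_mem (by exact z2) _
          rw [e1, e2, ← ENNReal.ofReal_add (by positivity) (by positivity)]
          exact ENNReal.ofReal_le_ofReal (by linarith)
    have hρ2 : ρ p.1 p.2 ^ 2 = ENNReal.ofReal ((ρ p.1 p.2).toReal ^ 2) := by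
      rw [ENNReal.ofReal_pow ENNReal.toReal_nonneg, ENNReal.ofReal_toReal htop]
    calc ENNReal.ofReal ((f p.1 - f p.2) ^ 2)
        ≤ ENNReal.ofReal (C / 2 * ((ρ p.1 p.2).toReal ^ 2 *
            ((f p.1 + 1) ^ 2 + (f p.2 + 1) ^ 2))) := by
          refine ENNReal.ofReal_le_ofReal ?_
          have e : f p.1 + 1 - (f p.2 + 1) = f p.1 - f p.2 := by ring
          rw [e] at hJB
          linarith
      _ = ENNReal.ofReal (C / 2) * (ρ p.1 p.2 ^ 2 *
            ENNReal.ofReal ((f p.1 + 1) ^ 2 + (f p.2 + 1) ^ 2)) := by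
          rw [ENNReal.ofReal_mul (by positivity), ENNReal.ofReal_mul (by positivity), hρ2]
      _ ≤ _ := by gcongr
  have hI1 : ∫⁻ p, ρ p.1 p.2 ^ 2 * A' p.1 ∂J ≤ ∫⁻ y, A y ∂m := by
    rw [lintegral_congr_ae hAm.ae_eq_mk]
    exact h.lintegral_fst_le hρJ hA'm
  have hI2 : ∫⁻ p, ρ p.1 p.2 ^ 2 * A' p.2 ∂J ≤ ∫⁻ y, A y ∂m := by
    refine le_trans (le_of_eq ?_) hI1
    rw [← hJ.measurePreserving_swap.lintegral_comp_emb
      MeasurableEquiv.prodComm.measurableEmbedding]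
    simp only [Prod.fst_swap, Prod.snd_swap]
    exact lintegral_congr fun p => by rw [hρ.symm]
  calc _ ≤ ∫⁻ p, ENNReal.ofReal (C / 2) *
          (ρ p.1 p.2 ^ 2 * A' p.1 + ρ p.1 p.2 ^ 2 * A' p.2) ∂J := lintegral_mono_ae hpt
    _ = ENNReal.ofReal (C / 2) *
          (∫⁻ p, ρ p.1 p.2 ^ 2 * A' p.1 ∂J + ∫⁻ p, ρ p.1 p.2 ^ 2 * A' p.2 ∂J) := by
        rw [lintegral_const_mul' _ _ ENNReal.ofReal_ne_top, lintegral_add_left']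
        exact (hρJ.pow_const 2).mul (hA'm.comp measurable_fst).aemeasurable
    _ ≤ ENNReal.ofReal (C / 2) * (∫⁻ y, A y ∂m + ∫⁻ y, A y ∂m) := by gcongr
    _ = ENNReal.ofReal C * ∫⁻ y, A y ∂m := by
        rw [← two_mul, ← mul_assoc]
        congr 1
        rw [show (2 : ℝ≥0∞) = ENNReal.ofReal 2 by simp, ← ENNReal.ofReal_mul (by positivity)]
        congr 1
        ring

end Energy

/-! ### Rayleigh quotients of the test functions -/

section Rayleigh

theorem ball_mono {X : Type*} (ρ : X → X → ℝ≥0∞) (x : X) : Monotone (ball ρ x) :=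
  fun _ _ h _ hy => le_trans hy (ENNReal.ofReal_le_ofReal h)

variable {X : Type*} [MeasurableSpace X] {ρ : X → X → ℝ≥0∞} {J : Measure (X × X)} {m : Measure X}

theorem ofReal_norm_toLp_sq {f : X → ℝ} (h : MemLp f 2 m) :
    ENNReal.ofReal (‖h.toLp f‖ ^ 2) = ∫⁻ y, ENNReal.ofReal (f y ^ 2) ∂m := by
  rw [ENNReal.ofReal_pow (norm_nonneg _), ofReal_norm, Lp.enorm_toLp]
  have := eLpNorm_nnreal_pow_eq_lintegral (μ := m) (f := f) (p := 2) two_ne_zero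
  simp only [ENNReal.coe_ofNat, NNReal.coe_ofNat, ENNReal.rpow_ofNat] at this
  rw [this]
  refine lintegral_congr fun y => ?_
  rw [← sq_abs, ENNReal.ofReal_pow (abs_nonneg _), Real.enorm_eq_ofReal_abs]

theorem mul_measure_ball_le_lintegral (hρ : IsPseudoMetric ρ) {r : ℕ} {x : X} {α : ℝ}
    (hα : 0 ≤ α) (hf : AEMeasurable (testFn ρ r x α) m) :
    ENNReal.ofReal ((Real.exp (α * r) - 1) ^ 2) * m (ball ρ x r) ≤
      ∫⁻ y, ENNReal.ofReal (testFn ρ r x α y ^ 2) ∂m := by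
  refine le_trans ?_ (mul_meas_ge_le_lintegral₀
    (f := fun y => ENNReal.ofReal (testFn ρ r x α y ^ 2)) (by fun_prop)
    (ENNReal.ofReal ((Real.exp (α * r) - 1) ^ 2)))
  gcongr
  intro y hy
  change _ ≤ ENNReal.ofReal (testFn ρ r x α y ^ 2)
  rw [testFn_eq_of_mem_ball hρ hα hy]

theorem measure_ball_lt_top (hρ : IsPseudoMetric ρ) {r : ℕ} (hr : 1 ≤ r) {x : X} {α : ℝ}
    (hα : 0 < α) (hf : MemLp (testFn ρ r x α) 2 m) : m (ball ρ x r) < ∞ := by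
  have h1 := mul_measure_ball_le_lintegral hρ hα.le hf.1.aemeasurable
  rw [← ofReal_norm_toLp_sq hf] at h1
  have hr' : (0 : ℝ) < r := by exact_mod_cast hr
  have h2 : 0 < Real.exp (α * r) - 1 := by
    linarith [Real.add_one_lt_exp (mul_pos hα hr').ne', mul_pos hα hr']
  by_contra hcon
  rw [not_lt, top_le_iff] at hcon
  rw [hcon, ENNReal.mul_top (by rw [Ne, ENNReal.ofReal_eq_zero, not_le]; positivity),
    top_le_iff] at h1
  exact ENNReal.ofReal_ne_top h1

theorem sqrt_measure_ball_le_norm (hρ : IsPseudoMetric ρ) {r : ℕ} {x : X} {α : ℝ}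
    (hα : 0 ≤ α) (hf : MemLp (testFn ρ r x α) 2 m) (hfin : m (ball ρ x r) ≠ ∞) :
    (Real.exp (α * r) - 1) * √(m (ball ρ x r)).toReal ≤ ‖hf.toLp _‖ := by
  have h1 := mul_measure_ball_le_lintegral hρ hα hf.1.aemeasurable
  rw [← ofReal_norm_toLp_sq hf, ← ENNReal.ofReal_toReal hfin,
    ← ENNReal.ofReal_mul (sq_nonneg _), ENNReal.ofReal_le_ofReal_iff (sq_nonneg _)] at h1
  refine (pow_le_pow_iff_left₀ (mul_nonneg ?_ (Real.sqrt_nonneg _)) (norm_nonneg _)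
    two_ne_zero).1 ?_
  · exact sub_nonneg.2 (Real.one_le_exp (by positivity))
  rwa [mul_pow, Real.sq_sqrt ENNReal.toReal_nonneg]

variable [TopologicalSpace X]

/-- On the support, `2f ≤ εf² + 1/ε` replaces `(f + 1)² + 1` by `(1 + ε)f² + (2 + 1/ε)`, and the
support lies in the ball of radius `2r`. -/
theorem form_testFn_le (hJ : IsJumpMeasure J) (hρ : IsPseudoMetric ρ)
    (hρJ : AEMeasurable (fun p : X × X => ρ p.1 p.2) J) (hadapted : IsAdapted ρ J m)
    {E : ClosedForm (Lp ℝ 2 m)} (hE : IsJumpForm E J)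
    {α C : ℝ} (hα : 0 < α) (hC : 0 < C)
    (hbound : ∀ᵐ p ∂J, ρ p.1 p.2 ≠ ∞ → ExpJumpBound α C (ρ p.1 p.2).toReal)
    {r : ℕ} {x : X} (hq : QuasiContinuous E (testFn ρ r x α))
    (hf : MemLp (testFn ρ r x α) 2 m) (hu : hf.toLp _ ∈ E.dom) {ε θ : ℝ} (hε : 0 < ε)
    (hθ : 0 ≤ θ)
    (hgrowth : m (ball ρ x (2 * r)) ≤ ENNReal.ofReal θ *
      ∫⁻ y, ENNReal.ofReal (testFn ρ r x α y ^ 2) ∂m) :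
    E.form ⟨_, hu⟩ ⟨_, hu⟩ ≤ C * (1 + ε + (2 + 1 / ε) * θ) * ‖hf.toLp _‖ ^ 2 := by
  have h1 := hE _ hf hu hq
  have h2 := lintegral_testFn_sub_sq_le hJ hρ hρJ hadapted hα hC hbound r x hf.1.aemeasurable
  rw [← h1] at h2
  set f := testFn ρ r x α with hfdef
  set I := ∫⁻ y, ENNReal.ofReal (f y ^ 2) ∂m with hI
  have h3 : ∫⁻ y, {y | f y ≠ 0}.indicator (fun y => ENNReal.ofReal ((f y + 1) ^ 2 + 1)) y ∂m ≤
      ENNReal.ofReal (1 + ε) * I + ENNReal.ofReal (2 + 1 / ε) * m (ball ρ x (2 * r)) := by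
    calc _ ≤ ∫⁻ y, (ENNReal.ofReal (1 + ε) * ENNReal.ofReal (f y ^ 2) +
          {y | f y ≠ 0}.indicator (fun _ => ENNReal.ofReal (2 + 1 / ε)) y) ∂m := by
          refine lintegral_mono fun y => ?_
          by_cases hy : f y = 0
          · rw [indicator_of_notMem (by simpa using hy)]
            exact bot_le
          · rw [indicator_of_mem (by exact hy), indicator_of_mem (by exact hy),
              ← ENNReal.ofReal_mul (by positivity), ← ENNReal.ofReal_add (by positivity)
              (by positivity)]
            refine ENNReal.ofReal_le_ofReal ?_
            have h4 : 0 ≤ ε * (f y - 1 / ε) ^ 2 := by positivity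
            have h5 : ε * (f y - 1 / ε) ^ 2 = ε * f y ^ 2 - 2 * f y + 1 / ε := by
              field_simp
              ring
            linarith
      _ = ENNReal.ofReal (1 + ε) * I +
          ∫⁻ y, {y | f y ≠ 0}.indicator (fun _ => ENNReal.ofReal (2 + 1 / ε)) y ∂m := by
          have hfm := hf.1.aemeasurable
          rw [lintegral_add_left' (by fun_prop), lintegral_const_mul' _ _ ENNReal.ofReal_ne_top]
      _ ≤ _ := by
          gcongr
          refine (lintegral_indicator_const_le _ _).trans ?_
          gcongr
          exact fun y hy => mem_ball_of_testFn_ne_zero hρ hα hy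
  have h4 : ENNReal.ofReal (E.form ⟨_, hu⟩ ⟨_, hu⟩) ≤
      ENNReal.ofReal (C * (1 + ε + (2 + 1 / ε) * θ) * ‖hf.toLp _‖ ^ 2) := by
    refine h2.trans ?_
    calc _ ≤ ENNReal.ofReal C * (ENNReal.ofReal (1 + ε) * I +
          ENNReal.ofReal (2 + 1 / ε) * (ENNReal.ofReal θ * I)) := by
          gcongr
          exact h3.trans (by gcongr)
      _ = _ := by
          rw [hI, ← ofReal_norm_toLp_sq hf, ← ENNReal.ofReal_mul hθ,
            ← ENNReal.ofReal_mul (by positivity), ← ENNReal.ofReal_mul (by positivity),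
            ← ENNReal.ofReal_add (by positivity) (by positivity),
            ← ENNReal.ofReal_mul hC.le]
          congr 1
          ring
  rwa [ENNReal.ofReal_le_ofReal_iff (by positivity)] at h4

/-- If the volume of the balls grows slowly from radius `r` to radius `2r`, then the Rayleigh
quotient of the test function is nearly `C`. -/
theorem exists_form_testFn_le (hJ : IsJumpMeasure J) (hρ : IsPseudoMetric ρ)
    (hρJ : AEMeasurable (fun p : X × X => ρ p.1 p.2) J) (hadapted : IsAdapted ρ J m)
    {E : ClosedForm (Lp ℝ 2 m)} (hE : IsJumpForm E J)
    {α C : ℝ} (hα : 0 < α) (hC : 0 < C)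
    (hbound : ∀ᵐ p ∂J, ρ p.1 p.2 ≠ ∞ → ExpJumpBound α C (ρ p.1 p.2).toReal)
    {ε : ℝ} (hε : 0 < ε) :
    ∃ θ > 0, ∃ r₀ : ℕ, 1 ≤ r₀ ∧ ∀ r ≥ r₀, ∀ x, QuasiContinuous E (testFn ρ r x α) →
      ∀ (hf : MemLp (testFn ρ r x α) 2 m) (hu : hf.toLp _ ∈ E.dom),
      m (ball ρ x (2 * r)) ≤ ENNReal.ofReal (θ * Real.exp (2 * α * r)) * m (ball ρ x r) →
      E.form ⟨_, hu⟩ ⟨_, hu⟩ ≤ C * (1 + ε) * ‖hf.toLp _‖ ^ 2 := by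
  set c := 2 + 1 / (ε / 2) with hc
  have hc0 : 0 < c := by positivity
  -- The radius threshold ensures `e^{αr} ≥ 2`, so `e^{2αr} ≤ 4(e^{αr} - 1)²`, whence the factor
  -- `4`. One `ε/2` pays for `f²`, the other for the volume error.
  refine ⟨ε / 2 / c / 4, by positivity, ⌈1 / α⌉₊ + 1, by omega, fun r hr x hq hf hu hg => ?_⟩
  have hαr : 1 ≤ α * r := by
    have h1 : 1 / α ≤ r := (Nat.le_ceil _).trans (by exact_mod_cast (by omega))
    rwa [div_le_iff₀ hα, mul_comm] at h1
  have hexp : 2 ≤ Real.exp (α * r) := by linarith [Real.add_one_le_exp (α * r)]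
  have h2 : m (ball ρ x (2 * r)) ≤ ENNReal.ofReal (ε / 2 / c) *
      ∫⁻ y, ENNReal.ofReal (testFn ρ r x α y ^ 2) ∂m := by
    refine hg.trans ?_
    calc _ ≤ ENNReal.ofReal (ε / 2 / c * (Real.exp (α * r) - 1) ^ 2) * m (ball ρ x r) := by
          gcongr ENNReal.ofReal ?_ * _
          have e : Real.exp (2 * α * r) = Real.exp (α * r) ^ 2 := by
            rw [← Real.exp_nat_mul]; congr 1; push_cast; ring
          rw [e, div_mul_eq_mul_div, mul_div_assoc]
          refine mul_le_mul_of_nonneg_left ?_ (by positivity)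
          nlinarith
      _ = ENNReal.ofReal (ε / 2 / c) *
          (ENNReal.ofReal ((Real.exp (α * r) - 1) ^ 2) * m (ball ρ x r)) := by
          rw [ENNReal.ofReal_mul (by positivity), mul_assoc]
      _ ≤ _ := by
          gcongr
          exact mul_measure_ball_le_lintegral hρ hα.le hf.1.aemeasurable
  have h3 := form_testFn_le hJ hρ hρJ hadapted hE hα hC hbound hq hf hu
    (show 0 < ε / 2 by positivity) (show 0 ≤ ε / 2 / c by positivity) h2
  rw [← hc, mul_div_cancel₀ _ hc0.ne'] at h3
  convert h3 using 3
  ring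

end Rayleigh

/-! ### Volume growth -/

/-- Induction by halving: the slack `α - β` absorbs `C` and the parity error. `K` is chosen before
`φ`, which later makes the bound uniform over centres. -/
theorem exists_linear_lower_bound {α β C : ℝ} {r₀ : ℕ} (hβ : 0 ≤ β) (hβα : β < α) :
    ∃ K : ℝ, ∀ φ : ℕ → ℝ, (∀ n, 1 ≤ n → 0 ≤ φ n) →
      (∀ a b, 1 ≤ a → a ≤ b → φ a ≤ φ b) →
      (∀ n ≥ r₀, 1 ≤ n → φ n + 2 * α * n - C ≤ φ (2 * n)) →
      ∀ n, 1 ≤ n → 2 * β * n - K ≤ φ n := by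
  -- The last entry makes `(α - β)n ≥ C + α + β`, exactly what the induction step needs; below `R₁`,
  -- non-negativity of `φ` suffices.
  set R₁ : ℕ := max (2 * r₀) (max 2 ⌈(C + α + β) / (α - β)⌉₊) with hR₁
  refine ⟨2 * β * R₁, fun φ h0 hmono hstep n => ?_⟩
  induction n using Nat.strong_induction_on with
  | _ n ih =>
    intro hn
    rcases lt_or_ge n R₁ with hlt | hge
    · have h1 : (n : ℝ) ≤ R₁ := by exact_mod_cast hlt.le
      nlinarith [h0 n hn]
    · have h1 : 2 * r₀ ≤ n := (le_max_left _ _).trans hge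
      have h2 : 2 ≤ n := ((le_max_left _ _).trans (le_max_right _ _)).trans hge
      have h3 : (C + α + β) / (α - β) ≤ n := (Nat.le_ceil _).trans
        (by exact_mod_cast ((le_max_right _ _).trans (le_max_right _ _)).trans hge)
      rw [div_le_iff₀ (by linarith)] at h3
      have h4 := ih (n / 2) (by omega) (by omega)
      have h5 := hstep (n / 2) (by omega) (by omega)
      have h6 := hmono (2 * (n / 2)) n (by omega) (by omega)
      have h7 : (n : ℝ) - 1 ≤ 2 * ((n / 2 : ℕ) : ℝ) := by
        have : n ≤ 2 * (n / 2) + 1 := by omega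
        have : (n : ℝ) ≤ 2 * ((n / 2 : ℕ) : ℝ) + 1 := by exact_mod_cast this
        linarith
      nlinarith

theorem exists_log_growth {α β θ : ℝ} {r₀ : ℕ} (hβ : 0 ≤ β) (hβα : β < α) (hθ : 0 < θ) :
    ∃ K : ℝ, ∀ V : ℝ → ℝ≥0∞, Monotone V → (∀ r, V r ≠ ∞) → 0 < V 1 →
      (∀ n : ℕ, r₀ ≤ n → ENNReal.ofReal (θ * Real.exp (2 * α * n)) * V n ≤ V (2 * n)) →
      ∀ R : ℝ, 1 ≤ R → 2 * β * R - K ≤ Real.log (V R).toReal - Real.log (V 1).toReal := by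
  obtain ⟨K, hK⟩ := exists_linear_lower_bound (C := -Real.log θ) (r₀ := r₀) hβ hβα
  refine ⟨K + 2 * β, fun V hV hfin hpos hstep R hR => ?_⟩
  have hp : ∀ r, 1 ≤ r → 0 < (V r).toReal := fun r hr =>
    ENNReal.toReal_pos (hpos.trans_le (hV hr)).ne' (hfin r)
  have hlog : ∀ a b, 1 ≤ a → a ≤ b → Real.log (V a).toReal ≤ Real.log (V b).toReal :=
    fun a b ha hab => Real.log_le_log (hp a ha) (ENNReal.toReal_mono (hfin b) (hV hab))
  have h1 := hK (fun n => Real.log (V n).toReal - Real.log (V 1).toReal)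
    (fun n hn => sub_nonneg.2 (hlog _ _ le_rfl (by exact_mod_cast hn)))
    (fun a b ha hab => sub_le_sub_right
      (hlog _ _ (by exact_mod_cast ha) (by exact_mod_cast hab)) _)
    (fun n hn hn1 => by
      have hn1' : (1 : ℝ) ≤ n := by exact_mod_cast hn1
      have h2 := ENNReal.toReal_mono (hfin _) (hstep n hn)
      rw [ENNReal.toReal_mul, ENNReal.toReal_ofReal (by positivity)] at h2
      have h3 := Real.log_le_log (mul_pos (by positivity) (hp n hn1')) h2
      rw [Real.log_mul (by positivity) (hp n hn1').ne',
        Real.log_mul hθ.ne' (Real.exp_pos _).ne', Real.log_exp] at h3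
      push_cast
      linarith)
    ⌊R⌋₊ (Nat.le_floor (by exact_mod_cast hR))
  have h4 := hlog ⌊R⌋₊ R (by exact_mod_cast Nat.le_floor (by exact_mod_cast hR))
    (Nat.floor_le (by linarith))
  have h5 := Nat.lt_floor_add_one R
  have h6 : 2 * β * (R - 1) ≤ 2 * β * ⌊R⌋₊ := by
    gcongr
    linarith
  linarith

section Growth

variable {X : Type*} [MeasurableSpace X] {ρ : X → X → ℝ≥0∞} {m : Measure X}

theorem log_measure_ball {x : X} {R : ℝ} (hR : 1 ≤ R) (hpos : 0 < m (ball ρ x 1))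
    (hfin : m (ball ρ x R) ≠ ∞) :
    ENNReal.log (m (ball ρ x R)) = (Real.log (m (ball ρ x R)).toReal : EReal) :=
  ENNReal.log_pos_real' (ENNReal.toReal_pos
    (hpos.trans_le (measure_mono (ball_mono ρ x hR))).ne' hfin)

theorem log_volumeRatio {x : X} {R : ℝ} (hR : 1 ≤ R) (hpos : 0 < m (ball ρ x 1))
    (hfin : m (ball ρ x R) ≠ ∞) :
    ENNReal.log (volumeRatio ρ m x R) =
      ((Real.log (m (ball ρ x R)).toReal - Real.log (m (ball ρ x 1)).toReal : ℝ) : EReal) := by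
  have hle := measure_mono (μ := m) (ball_mono ρ x hR)
  have h1 : m (ball ρ x 1) ≠ ∞ := ne_top_of_le_ne_top hfin hle
  have p1 := ENNReal.toReal_pos hpos.ne' h1
  have pR := ENNReal.toReal_pos (hpos.trans_le hle).ne' hfin
  rw [volumeRatio, if_neg hfin, ENNReal.log_pos_real', ENNReal.toReal_div,
    Real.log_div pR.ne' p1.ne']
  rw [ENNReal.toReal_div]
  positivity

theorem minVolumeGrowth_nonneg (hpos : ∀ x, 0 < m (ball ρ x 1)) :
    0 ≤ minVolumeGrowth ρ m := by
  refine le_liminf_of_le (by isBoundedDefault) ?_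
  filter_upwards [eventually_ge_atTop 1] with R hR
  refine mul_nonneg (EReal.coe_nonneg.2 (by positivity)) (le_iInf fun x => ?_)
  rw [ENNReal.zero_le_log_iff, volumeRatio]
  split_ifs with h
  · exact le_top
  · have hle := measure_mono (μ := m) (ball_mono ρ x hR)
    rw [ENNReal.le_div_iff_mul_le (Or.inl (hpos x).ne') (Or.inr h), one_mul]
    exact hle

theorem eventually_le_inv_mul {a b K : ℝ} (hab : a < b) :
    ∀ᶠ R : ℝ in atTop, a ≤ 1 / R * (b * R - K) := by
  filter_upwards [eventually_gt_atTop 0, eventually_ge_atTop (K / (b - a))] with R h0 hR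
  rw [div_le_iff₀ (by linarith)] at hR
  rw [one_div, inv_mul_eq_div, le_div_iff₀ h0]
  linarith

/-- If every centre grew fast at all radii from `r₀` on, `exists_log_growth` would give one constant
for all centres; this survives the infimum and pushes the growth rate up to `b`. -/
theorem exists_slow_growth_of_minVolumeGrowth_lt (hpos : ∀ x, 0 < m (ball ρ x 1))
    (hfin : ∀ x r, m (ball ρ x r) ≠ ∞) {α θ : ℝ} (hθ : 0 < θ) {r₀ : ℕ}
    (h : minVolumeGrowth ρ m < ((2 * α : ℝ) : EReal)) :
    ∃ r ≥ r₀, ∃ x, m (ball ρ x (2 * r)) ≤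
      ENNReal.ofReal (θ * Real.exp (2 * α * (r : ℕ))) * m (ball ρ x r) := by
  by_contra! hcon
  obtain ⟨b, hb1, hb2⟩ := EReal.lt_iff_exists_real_btwn.1 h
  rw [EReal.coe_lt_coe_iff] at hb2
  have hb0 : 0 < b := by
    have := (minVolumeGrowth_nonneg hpos).trans_lt hb1
    exact_mod_cast this
  obtain ⟨K, hK⟩ := exists_log_growth (α := α) (β := (b / 2 + α) / 2) (r₀ := r₀)
    (by linarith) (by linarith) hθ
  refine hb1.not_ge (le_liminf_of_le (by isBoundedDefault) ?_)
  filter_upwards [eventually_ge_atTop 1,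
    eventually_le_inv_mul (a := b) (b := 2 * ((b / 2 + α) / 2)) (K := K) (by linarith)]
    with R hR hR2
  refine (EReal.coe_le_coe_iff.2 hR2).trans ?_
  rw [EReal.coe_mul]
  refine mul_le_mul_of_nonneg_left (le_iInf fun x => ?_) (EReal.coe_nonneg.2 (by positivity))
  rw [log_volumeRatio hR (hpos x) (hfin x R), EReal.coe_le_coe_iff]
  exact hK (fun r => m (ball ρ x r)) (fun a b hab => measure_mono (ball_mono ρ x hab)) (hfin x)
    (hpos x) (fun n hn => (hcon n hn x).le) R hR

theorem exists_slow_growth_of_volumeGrowth_lt {x : X} (hpos : 0 < m (ball ρ x 1))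
    (hfin : ∀ r, m (ball ρ x r) ≠ ∞) {α θ : ℝ} (hα : 0 < α) (hθ : 0 < θ) (r₀ : ℕ)
    (h : volumeGrowth ρ m x < ((2 * α : ℝ) : EReal)) :
    ∃ r ≥ r₀, m (ball ρ x (2 * r)) ≤
      ENNReal.ofReal (θ * Real.exp (2 * α * (r : ℕ))) * m (ball ρ x r) := by
  by_contra! hcon
  obtain ⟨b₀, hb₁, hb₂⟩ := EReal.lt_iff_exists_real_btwn.1 h
  -- The growth at one point may be negative for a finite total volume, whereas the iteration needs
  -- a rate `β ≥ 0`.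
  set b := max b₀ 0
  have hb1 : volumeGrowth ρ m x < b :=
    hb₁.trans_le (EReal.coe_le_coe_iff.2 (le_max_left _ _))
  have hb2 : b < 2 * α := max_lt (EReal.coe_lt_coe_iff.1 hb₂) (by linarith)
  have hb0 : 0 ≤ b := le_max_right _ _
  obtain ⟨K, hK⟩ := exists_log_growth (α := α) (β := (b / 2 + α) / 2) (r₀ := r₀)
    (by linarith) (by linarith) hθ
  refine hb1.not_ge (le_liminf_of_le (by isBoundedDefault) ?_)
  filter_upwards [eventually_ge_atTop 1, eventually_le_inv_mul (a := b)
    (b := 2 * ((b / 2 + α) / 2)) (K := K - Real.log (m (ball ρ x 1)).toReal) (by linarith)]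
    with R hR hR2
  refine (EReal.coe_le_coe_iff.2 hR2).trans ?_
  rw [EReal.coe_mul]
  refine mul_le_mul_of_nonneg_left ?_ (EReal.coe_nonneg.2 (by positivity))
  rw [log_measure_ball hR hpos (hfin R), EReal.coe_le_coe_iff]
  have := hK (fun r => m (ball ρ x r)) (fun a b hab => measure_mono (ball_mono ρ x hab)) hfin
    hpos (fun n hn => (hcon n hn).le) R hR
  linarith

/-- For a fixed centre the normalisation by the unit ball vanishes after division by `R`. This
places the test functions in the domain for exponents above half the growth at a point. -/
theorem minVolumeGrowth_le_volumeGrowth (hpos : ∀ x, 0 < m (ball ρ x 1)) (x : X) :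
    minVolumeGrowth ρ m ≤ volumeGrowth ρ m x := by
  refine EReal.le_of_forall_lt_iff_le.1 fun s hs => ?_
  obtain ⟨t, ht1, ht2⟩ := EReal.lt_iff_exists_real_btwn.1 hs
  rw [EReal.coe_lt_coe_iff] at ht2
  refine liminf_le_of_frequently_le' ?_
  have hfreq := frequently_lt_of_liminf_lt (by isBoundedDefault) ht1
  refine (hfreq.and_eventually ((eventually_ge_atTop 1).and (eventually_le_inv_mul (a := t)
    (b := s) (K := -Real.log (m (ball ρ x 1)).toReal) ht2))).mono ?_
  rintro R ⟨h1, hR, h2⟩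
  have hR0 : 0 < R := by linarith
  have hRinv : (0 : EReal) < ((1 / R : ℝ) : EReal) := EReal.coe_pos.2 (by positivity)
  have hfin : m (ball ρ x R) ≠ ∞ := by
    intro htop
    rw [htop, ENNReal.log_top, EReal.mul_top_of_pos hRinv] at h1
    exact not_top_lt h1
  rw [log_measure_ball hR (hpos x) hfin, ← EReal.coe_mul, EReal.coe_lt_coe_iff] at h1
  refine (mul_le_mul_of_nonneg_left (iInf_le _ x) hRinv.le).trans ?_
  rw [log_volumeRatio hR (hpos x) hfin, ← EReal.coe_mul, EReal.coe_le_coe_iff]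
  have e : 1 / R * (s * R - -Real.log (m (ball ρ x 1)).toReal) =
      s + 1 / R * Real.log (m (ball ρ x 1)).toReal := by
    field_simp
    ring
  rw [e] at h2
  rw [mul_sub]
  linarith

end Growth

/-! ### Spectral bounds -/

section Bounds

variable {X : Type*} [MeasurableSpace X] {ρ : X → X → ℝ≥0∞} {J : Measure (X × X)} {m : Measure X}

/-- The normalised test functions converge weakly to zero if the volume of the balls tends to
infinity. -/
theorem tendsto_inner_testFn_div_norm (hρ : IsPseudoMetric ρ) {x : X} {α : ℝ} (hα : 0 < α)
    (hfin : ∀ r, m (ball ρ x r) ≠ ∞) (htop : m (⋃ r : ℝ, ball ρ x r) = ∞)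
    {r : ℕ → ℕ} (hr : ∀ k, k ≤ r k) (hr1 : ∀ k, 1 ≤ r k)
    (hf : ∀ k, MemLp (testFn ρ (r k) x α) 2 m) (hne : ∀ k, 0 < ‖(hf k).toLp _‖)
    (v : Lp ℝ 2 m) :
    Tendsto (fun k => inner ℝ v ((hf k).toLp _) / ‖(hf k).toLp _‖) atTop (𝓝 0) := by
  have hvol : Tendsto (fun k => √(m (ball ρ x (r k))).toReal) atTop atTop := by
    refine Real.tendsto_sqrt_atTop.comp (tendsto_atTop.2 fun M => ?_)
    have h1 : Tendsto (fun R : ℝ => m (ball ρ x R)) atTop (𝓝 ∞) := by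
      rw [← htop]
      exact tendsto_measure_iUnion_atTop (ball_mono ρ x)
    have h2 : Tendsto (fun k => (r k : ℝ)) atTop atTop :=
      tendsto_natCast_atTop_atTop.comp (tendsto_atTop_mono hr tendsto_id)
    filter_upwards [(h1.comp h2).eventually
      (lt_mem_nhds (ENNReal.ofReal_lt_top (r := M)))] with k hk
    exact (ENNReal.ofReal_le_iff_le_toReal (hfin _)).1 (le_of_lt hk)
  -- Bounding `f` by its supremum gives `|⟨w, f⟩| ≤ (e^{αr} - 1)‖w‖₁`, while `‖f‖ ≥ (e^{αr} -
  -- 1)√m(B_r)`; the quotient is at most `‖w‖₁/√m(B_r)`.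
  have hsimple : ∀ w : Lp.simpleFunc ℝ 2 m, Tendsto (fun k =>
      inner ℝ (w : Lp ℝ 2 m) ((hf k).toLp _) / ‖(hf k).toLp _‖) atTop (𝓝 0) := by
    intro w
    have hint : Integrable (w : Lp ℝ 2 m) m := by
      have h1 : Integrable (Lp.simpleFunc.toSimpleFunc w) m :=
        (SimpleFunc.memLp_iff_integrable two_ne_zero ENNReal.ofNat_ne_top).1
          (Lp.simpleFunc.memLp w)
      exact h1.congr (Lp.simpleFunc.toSimpleFunc_eq_toFun w)
    set I := ∫ y, ‖(w : Lp ℝ 2 m) y‖ ∂m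
    have hI : Tendsto (fun k => I / √(m (ball ρ x (r k))).toReal) atTop (𝓝 0) :=
      hvol.const_div_atTop I
    refine squeeze_zero_norm' ?_ hI
    filter_upwards [hvol.eventually_gt_atTop 0] with k hk
    have hrk : (0 : ℝ) < r k := by exact_mod_cast hr1 k
    set A := Real.exp (α * r k) - 1
    have hA : 0 < A := by
      linarith [Real.add_one_lt_exp (mul_pos hα hrk).ne', mul_pos hα hrk]
    have hnorm := sqrt_measure_ball_le_norm hρ hα.le (hf k) (hfin _)
    have hinner : ‖inner ℝ (w : Lp ℝ 2 m) ((hf k).toLp _)‖ ≤ A * I := by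
      rw [L2.inner_def]
      calc _ ≤ ∫ y, A * ‖(w : Lp ℝ 2 m) y‖ ∂m := by
            refine norm_integral_le_of_norm_le (hint.norm.const_mul A) ?_
            filter_upwards [(hf k).coeFn_toLp] with y hy
            rw [hy]
            refine (norm_inner_le_norm _ _).trans ?_
            rw [mul_comm, Real.norm_of_nonneg (testFn_nonneg ρ (r k) x α y)]
            gcongr
            exact testFn_le ρ (r k) x hα.le y
        _ = _ := integral_const_mul _ _
    rw [norm_div, norm_norm, div_le_div_iff₀ (hne k) hk]
    have hI0 : 0 ≤ I := integral_nonneg fun _ => norm_nonneg _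
    calc _ ≤ A * I * √(m (ball ρ x (r k))).toReal := by gcongr
      _ = I * (A * √(m (ball ρ x (r k))).toReal) := by ring
      _ ≤ _ := by gcongr
  rw [Metric.tendsto_nhds]
  intro ε hε
  obtain ⟨w, hw⟩ := (Lp.simpleFunc.denseRange (E := ℝ) (p := 2) (μ := m)
    ENNReal.ofNat_ne_top).exists_dist_lt v (half_pos hε)
  filter_upwards [(Metric.tendsto_nhds.1 (hsimple w)) (ε / 2) (half_pos hε)] with k hk
  rw [Real.dist_0_eq_abs] at hk ⊢
  have e : inner ℝ v ((hf k).toLp _) = inner ℝ (v - w) ((hf k).toLp _) +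
      inner ℝ (w : Lp ℝ 2 m) ((hf k).toLp _) := by
    rw [inner_sub_left]; ring
  rw [e, add_div]
  refine (abs_add_le _ _).trans_lt ?_
  have h1 : |inner ℝ (v - w) ((hf k).toLp _) / ‖(hf k).toLp _‖| < ε / 2 := by
    rw [abs_div, abs_norm, div_lt_iff₀ (hne k)]
    refine (abs_real_inner_le_norm _ _).trans_lt ?_
    rw [dist_eq_norm] at hw
    exact mul_lt_mul_of_pos_right hw (hne k)
  linarith

theorem norm_toLp_testFn_pos (hρ : IsPseudoMetric ρ) {x : X} {α : ℝ} (hα : 0 < α)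
    (hpos : 0 < m (ball ρ x 1)) (hfin : ∀ r, m (ball ρ x r) ≠ ∞) {r : ℕ} (hr : 1 ≤ r)
    (hf : MemLp (testFn ρ r x α) 2 m) : 0 < ‖hf.toLp _‖ := by
  have hr' : (1 : ℝ) ≤ r := by exact_mod_cast hr
  refine lt_of_lt_of_le (mul_pos ?_ (Real.sqrt_pos.2 (ENNReal.toReal_pos ?_ (hfin r))))
    (sqrt_measure_ball_le_norm hρ hα.le hf (hfin r))
  · have : 0 < α * r := by positivity
    linarith [Real.add_one_lt_exp this.ne']
  · exact (hpos.trans_le (measure_mono (ball_mono ρ x hr'))).ne'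

variable [TopologicalSpace X] {E : ClosedForm (Lp ℝ 2 m)}

theorem measure_ball_ne_top (hρ : IsPseudoMetric ρ) {x : X} {α : ℝ} (hα : 0 < α)
    (hf : ∀ r, MemDomain E (testFn ρ r x α)) (R : ℝ) : m (ball ρ x R) ≠ ∞ := by
  obtain ⟨-, h, -⟩ := hf (⌈R⌉₊ + 1)
  refine ne_top_of_le_ne_top (measure_ball_lt_top hρ (by omega) hα h).ne
    (measure_mono (ball_mono ρ x ?_))
  push_cast
  linarith [Nat.le_ceil R]

/-- The bound for the bottom of the spectrum at a fixed exponent. -/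
theorem bottom_le_of_expJumpBound (hJ : IsJumpMeasure J) (hρ : IsPseudoMetric ρ)
    (hρJ : AEMeasurable (fun p : X × X => ρ p.1 p.2) J) (hadapted : IsAdapted ρ J m)
    (hball : ∀ x, 0 < m (ball ρ x 1)) (hE : IsJumpForm E J)
    {α C : ℝ} (hα : 0 < α) (hC : 0 < C)
    (hbound : ∀ᵐ p ∂J, ρ p.1 p.2 ≠ ∞ → ExpJumpBound α C (ρ p.1 p.2).toReal)
    (hf : ∀ (r : ℕ) (x : X), MemDomain E (testFn ρ r x α))
    (hgrowth : minVolumeGrowth ρ m < ((2 * α : ℝ) : EReal)) : bottom E.operator ≤ C := by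
  have hfin : ∀ x r, m (ball ρ x r) ≠ ∞ := fun x =>
    measure_ball_ne_top hρ hα fun r => hf r x
  refine EReal.le_of_forall_lt_iff_le.1 fun z hz => ?_
  rw [EReal.coe_lt_coe_iff] at hz
  obtain ⟨θ, hθ, r₀, hr₀, H⟩ := exists_form_testFn_le hJ hρ hρJ hadapted hE hα hC hbound
    (ε := (z - C) / C) (div_pos (by linarith) hC)
  obtain ⟨r, hr, x, hx⟩ := exists_slow_growth_of_minVolumeGrowth_lt hball hfin hθ (r₀ := r₀)
    hgrowth
  obtain ⟨hq, hm, hu⟩ := hf r x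
  have h1 := H r hr x hq hm hu hx
  have h2 : C * (1 + (z - C) / C) = z := by field_simp; ring
  rw [h2] at h1
  exact E.bottom_le ⟨_, hu⟩
    (norm_pos_iff.1 (norm_toLp_testFn_pos hρ hα (hball x) (hfin x) (hr₀.trans hr) hm)) h1

/-- The bound for the bottom of the essential spectrum at a fixed exponent. -/
theorem essBottom_le_of_expJumpBound (hJ : IsJumpMeasure J) (hρ : IsPseudoMetric ρ)
    (hρJ : AEMeasurable (fun p : X × X => ρ p.1 p.2) J) (hadapted : IsAdapted ρ J m)
    {x : X} (hball : 0 < m (ball ρ x 1)) (hE : IsJumpForm E J)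
    {α C : ℝ} (hα : 0 < α) (hC : 0 < C)
    (hbound : ∀ᵐ p ∂J, ρ p.1 p.2 ≠ ∞ → ExpJumpBound α C (ρ p.1 p.2).toReal)
    (hf : ∀ r : ℕ, MemDomain E (testFn ρ r x α))
    (htop : m (⋃ r : ℝ, ball ρ x r) = ∞)
    (hgrowth : volumeGrowth ρ m x < ((2 * α : ℝ) : EReal)) : essBottom E.operator ≤ C := by
  have hfin := measure_ball_ne_top hρ hα hf
  refine EReal.le_of_forall_lt_iff_le.1 fun z hz => ?_
  rw [EReal.coe_lt_coe_iff] at hz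
  obtain ⟨θ, hθ, r₀, hr₀, H⟩ := exists_form_testFn_le hJ hρ hρJ hadapted hE hα hC hbound
    (ε := (z - C) / C) (div_pos (by linarith) hC)
  -- The lower bound `max r₀ k` sends the radii to infinity, as weak convergence to zero requires.
  choose r hr hx using fun k => exists_slow_growth_of_volumeGrowth_lt hball hfin hα hθ
    (max r₀ k) hgrowth
  choose hq hm hu using hf
  have hr1 : ∀ k, 1 ≤ r k := fun k => hr₀.trans ((le_max_left _ _).trans (hr k))
  have hpos : ∀ k, 0 < ‖(hm (r k)).toLp _‖ := fun k =>
    norm_toLp_testFn_pos hρ hα hball hfin (hr1 k) _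
  have h2 : C * (1 + (z - C) / C) = z := by field_simp; ring
  refine E.essBottom_le (fun k => ⟨_, hu (r k)⟩) (fun k => norm_pos_iff.1 (hpos k))
    (fun k => ?_) fun v => ?_
  · have h1 := H (r k) ((le_max_left _ _).trans (hr k)) x (hq _) (hm _) (hu _) (hx k)
    rw [h2] at h1
    exact h1
  · exact tendsto_inner_testFn_div_norm hρ hα hfin htop
      (fun k => (le_max_right _ _).trans (hr k)) hr1 (fun k => hm (r k)) hpos v

end Bounds

theorem ae_expJumpBound_of_hasJumpSizeIn {X : Type*} [MeasurableSpace X] {ρ : X → X → ℝ≥0∞}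
    {J : Measure (X × X)} (hρJ : AEMeasurable (fun p : X × X => ρ p.1 p.2) J) {α δ : ℝ}
    (hα : 0 ≤ α) (hδ : 0 ≤ δ) (h : HasJumpSizeIn ρ J δ 1) :
    ∀ᵐ p ∂J, ρ p.1 p.2 ≠ ∞ → ExpJumpBound α
      (2 * (Real.exp α - 1) ^ 2 / (δ ^ 2 * Real.exp α ^ 2 + 1)) (ρ p.1 p.2).toReal := by
  have hset : NullMeasurableSet
      {p : X × X | ρ p.1 p.2 ∈ Icc (ENNReal.ofReal δ) (ENNReal.ofReal 1)}ᶜ J :=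
    (hρJ.nullMeasurable measurableSet_Icc).compl
  rw [HasJumpSizeIn, lintegral_eq_zero_iff' (hρJ.pow_const 2).restrict] at h
  have h1 := (ae_restrict_iff'₀ hset).1 h
  filter_upwards [h1] with p hp htop
  by_cases hmem : ρ p.1 p.2 ∈ Icc (ENNReal.ofReal δ) (ENNReal.ofReal 1)
  · refine expJumpBound_jumpSize hα hδ ((ENNReal.ofReal_le_iff_le_toReal htop).1 hmem.1) ?_
    exact ENNReal.toReal_le_of_le_ofReal zero_le_one hmem.2
  -- Outside the prescribed jump range `ρ = 0` almost everywhere, so `a = b` and both sides vanish.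
  · have h2 := hp hmem
    simp only [Pi.zero_apply, pow_eq_zero_iff two_ne_zero] at h2
    intro a b hab
    rw [h2, ENNReal.toReal_zero, mul_zero] at hab
    rw [sub_eq_zero.1 (abs_nonpos_iff.1 hab), sub_self, h2]
    simp

theorem le_of_forall_gt_of_continuousAt {B : EReal} {F : ℝ → ℝ} {a : ℝ} (hF : ContinuousAt F a)
    (h : ∀ α > a, B ≤ F α) : B ≤ F a := by
  have h1 : Tendsto (fun α => (F α : EReal)) (𝓝[>] a) (𝓝 (F a : EReal)) :=
    (continuous_coe_real_ereal.tendsto _).comp (hF.tendsto.mono_left nhdsWithin_le_nhds)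
  exact ge_of_tendsto h1 (eventually_mem_nhdsWithin.mono fun α hα => h α hα)

end JumpSpectrum

end

/-! ### Conclusion: the exponent decreases to half the growth rate. -/

theorem theorem3 {X : Type*} [MetricSpace X] [LocallyCompactSpace X]
    [TopologicalSpace.SeparableSpace X] [MeasurableSpace X] [BorelSpace X]
    (m : Measure X) [IsFiniteMeasureOnCompacts m] [m.IsOpenPosMeasure]
    (J : Measure (X × X)) (hJ : JumpSpectrum.IsJumpMeasure J)
    (ρ : X → X → ℝ≥0∞) (hρ : JumpSpectrum.IsPseudoMetric ρ)
    (hρJ : AEMeasurable (fun p : X × X => ρ p.1 p.2) J)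
    (hadapted : JumpSpectrum.IsAdapted ρ J m)
    (hball : ∀ x, 0 < m (JumpSpectrum.ball ρ x 1))
    (E : JumpSpectrum.ClosedForm (Lp ℝ 2 m)) (hE : JumpSpectrum.IsJumpForm E J)
    (hf : ∀ (r : ℕ) (x : X) (α : ℝ), JumpSpectrum.minVolumeGrowth ρ m / 2 < (α : EReal) →
      JumpSpectrum.MemDomain E (JumpSpectrum.testFn ρ r x α)) :
    (JumpSpectrum.bottom E.operator ≤ JumpSpectrum.minVolumeGrowth ρ m ^ 2 / 4 ∧
      ∀ x₀ : X, m (⋃ r : ℝ, JumpSpectrum.ball ρ x₀ r) = ∞ →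
        JumpSpectrum.essBottom E.operator ≤ JumpSpectrum.volumeGrowth ρ m x₀ ^ 2 / 4) ∧
    ∀ δ : ℝ, 0 ≤ δ → δ ≤ 1 → JumpSpectrum.HasJumpSizeIn ρ J δ 1 →
      (∀ t : ℝ, JumpSpectrum.minVolumeGrowth ρ m = (t : EReal) →
        JumpSpectrum.bottom E.operator ≤
          ((2 * (Real.exp (t / 2) - 1) ^ 2 / (δ ^ 2 * Real.exp t + 1) : ℝ) : EReal)) ∧
      ∀ x₀ : X, m (⋃ r : ℝ, JumpSpectrum.ball ρ x₀ r) = ∞ →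
        ∀ t : ℝ, JumpSpectrum.volumeGrowth ρ m x₀ = (t : EReal) →
          JumpSpectrum.essBottom E.operator ≤
            ((2 * (Real.exp (t / 2) - 1) ^ 2 / (δ ^ 2 * Real.exp t + 1) : ℝ) : EReal) := by
  have hmin0 := JumpSpectrum.minVolumeGrowth_nonneg hball
  have hle := JumpSpectrum.minVolumeGrowth_le_volumeGrowth hball
  have hlt : ∀ {g : EReal} {t α : ℝ}, g ≤ (t : EReal) → t / 2 < α →
      g < ((2 * α : ℝ) : EReal) := fun hg hα =>
    hg.trans_lt (EReal.coe_lt_coe_iff.2 (by linarith))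
  have hdom : ∀ {t α : ℝ}, JumpSpectrum.minVolumeGrowth ρ m ≤ (t : EReal) → t / 2 < α →
      ∀ (r : ℕ) (x : X), JumpSpectrum.MemDomain E (JumpSpectrum.testFn ρ r x α) := by
    intro t α hg hα r x
    refine hf r x α (lt_of_le_of_lt ?_ (EReal.coe_lt_coe_iff.2 hα))
    rw [EReal.coe_div]
    exact EReal.div_le_div_right_of_nonneg (by norm_num) hg
  have hnonneg : ∀ {t : ℝ}, JumpSpectrum.minVolumeGrowth ρ m ≤ (t : EReal) → 0 ≤ t :=
    fun hg => EReal.coe_nonneg.1 (hmin0.trans hg)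
  -- Non-negativity excludes `g = -∞`, and for `g = ∞` the bound is trivial, so only real growth
  -- rates remain.
  have hsquare : ∀ {B g : EReal}, 0 ≤ g →
      (∀ t : ℝ, g = (t : EReal) → B ≤ (((t / 2) ^ 2 : ℝ) : EReal)) → B ≤ g ^ 2 / 4 := by
    intro B g hg h
    induction g with
    | bot => exact absurd hg (by simp)
    | top =>
      have h4 : (4 : EReal) = ((4 : ℝ) : EReal) := rfl
      rw [pow_two, EReal.top_mul_top, h4, EReal.top_div_of_pos_ne_top (by norm_num) (by simp)]
      exact le_top
    | coe t =>
      refine (h t rfl).trans (le_of_eq ?_)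
      have h4 : (4 : EReal) = ((4 : ℝ) : EReal) := rfl
      rw [h4, ← EReal.coe_pow, ← EReal.coe_div]
      congr 1
      ring
  have hjump : ∀ (δ t : ℝ), ContinuousAt (fun α : ℝ =>
      2 * (Real.exp α - 1) ^ 2 / (δ ^ 2 * Real.exp α ^ 2 + 1)) (t / 2) := fun δ t =>
    ContinuousAt.div (by fun_prop) (by fun_prop) (by positivity)
  have hexp : ∀ t : ℝ, Real.exp (t / 2) ^ 2 = Real.exp t := fun t => by
    rw [← Real.exp_nat_mul]; congr 1; push_cast; ring
  have hC : ∀ {δ α : ℝ}, 0 < α →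
      0 < 2 * (Real.exp α - 1) ^ 2 / (δ ^ 2 * Real.exp α ^ 2 + 1) := fun {δ α} hα => by
    have : 0 < Real.exp α - 1 := by linarith [Real.add_one_lt_exp hα.ne']
    positivity
  refine ⟨⟨hsquare hmin0 fun t ht => ?_, fun x₀ htop => hsquare (hmin0.trans (hle x₀))
    fun t ht => ?_⟩, fun δ hδ _ hjs => ⟨fun t ht => ?_, fun x₀ htop t ht => ?_⟩⟩
  · refine JumpSpectrum.le_of_forall_gt_of_continuousAt (F := fun α => α ^ 2)
      (by fun_prop) fun α hα => ?_
    have hα0 : 0 < α := by linarith [hnonneg ht.le]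
    exact JumpSpectrum.bottom_le_of_expJumpBound hJ hρ hρJ hadapted hball hE hα0 (by positivity)
      (Eventually.of_forall fun _ _ => JumpSpectrum.expJumpBound_sq) (hdom ht.le hα)
      (hlt ht.le hα)
  · have ht' := (hle x₀).trans ht.le
    refine JumpSpectrum.le_of_forall_gt_of_continuousAt (F := fun α => α ^ 2)
      (by fun_prop) fun α hα => ?_
    have hα0 : 0 < α := by linarith [hnonneg ht']
    exact JumpSpectrum.essBottom_le_of_expJumpBound hJ hρ hρJ hadapted (hball x₀) hE hα0
      (by positivity) (Eventually.of_forall fun _ _ => JumpSpectrum.expJumpBound_sq)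
      (fun r => hdom ht' hα r x₀) htop (hlt ht.le hα)
  · rw [← hexp t]
    refine JumpSpectrum.le_of_forall_gt_of_continuousAt
      (F := fun α => 2 * (Real.exp α - 1) ^ 2 / (δ ^ 2 * Real.exp α ^ 2 + 1))
      (hjump δ t) fun α hα => ?_
    have hα0 : 0 < α := by linarith [hnonneg ht.le]
    exact JumpSpectrum.bottom_le_of_expJumpBound hJ hρ hρJ hadapted hball hE hα0 (hC hα0)
      (JumpSpectrum.ae_expJumpBound_of_hasJumpSizeIn hρJ hα0.le hδ hjs) (hdom ht.le hα)
      (hlt ht.le hα)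
  · have ht' := (hle x₀).trans ht.le
    rw [← hexp t]
    refine JumpSpectrum.le_of_forall_gt_of_continuousAt
      (F := fun α => 2 * (Real.exp α - 1) ^ 2 / (δ ^ 2 * Real.exp α ^ 2 + 1))
      (hjump δ t) fun α hα => ?_
    have hα0 : 0 < α := by linarith [hnonneg ht']
    exact JumpSpectrum.essBottom_le_of_expJumpBound hJ hρ hρJ hadapted (hball x₀) hE hα0
      (hC hα0) (JumpSpectrum.ae_expJumpBound_of_hasJumpSizeIn hρJ hα0.le hδ hjs)
      (fun r => hdom ht' hα r x₀) htop (hlt ht.le hα)
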